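/- Write $\mathbb N_0=\{0,1,2,\dots\}$. A family $\mathscr F$ of subsets of $\mathbb N_0$ is a \emph{Furstenberg family} if $\emptyset\notin\mathscr F\neq\emptyset$ and every $G\subset\mathbb N_0$ containing a member of $\mathscr F$ belongs to $\mathscr F$. It is a \emph{hypercyclicity set} if, moreover, there are pairwise disjoint sets $A_1,A_2,\dots\in\mathscr F$ such that $|j-j'|\ge\max\{k,k'\}$ whenever $j\in A_k$, $j'\in A_{k'}$ and $j\ne j'$. It is \emph{right-invariant} if, for every $E\subset\mathbb N_0$, $E\in\mathscr F$ if and only if $p+E\in\mathscr F$ for all $p\in\mathbb N_0$. All Banach spaces are complex, separable and infinite-dimensional. For $\Gamma\subset\mathbb C$, a bounded linear operator $T$ on a Banach space $X$ and $x\in X$, we say that $x$ is an \emph{$\mathscr F_\Gamma$-hypercyclic vector} for $T$ if $\{n\in\mathbb N_0: T^n(\Gamma x)\cap U\neq\emptyset\}\in\mathscr F$ for every non-empty open set $U\subset X$. The set $\Gamma$ is an \emph{$\mathscr F$-hypercyclic scalar set} if for every Banach space $Y$, every bounded linear operator $S$ on $Y$ and every $y\in Y$, the vector $y$ is $\mathscr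 F_\Gamma$-hypercyclic for $S$ if and only if it is $\mathscr F_{\{1\}}$-hypercyclic for $S$. \textbf{Theorem.} Let $\mathscr F$ be a hypercyclicity set and $\Gamma\subset\mathbb C$. (a) If $\Gamma$ is an $\mathscr F$-hypercyclic scalar set, then $\Gamma\setminus\{0\}$ is non-empty and bounded, and every sequence $(\alpha_k)_{k\ge0}$ in $\Gamma\setminus\{0\}$ whose moduli $|\alpha_k|$ are non-increasing and converge to $0$ satisfies $\lim_{k\to\infty}|\alpha_{k+1}|/|\alpha_k|=0$. (b) If $\mathscr F$ is right-invariant and its complement $\mathscr P(\mathbb N_0)\setminus\mathscr F$ is closed under finite unions, and if $\Gamma\setminus\{0\}$ is non-empty, bounded and bounded away from zero, then $\Gamma$ is an $\mathscr F$-hypercyclic scalar set. -/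

import Mathlib

universe u

/-- A Furstenberg family on `ℕ₀`: non-trivial and hereditarily upward. -/
structure IsFurstenbergFamily (F : Set (Set ℕ)) : Prop where
  nonempty : F.Nonempty
  empty_notMem : ∅ ∉ F
  upward : ∀ E G : Set ℕ, E ⊆ G → E ∈ F → G ∈ F

/-- A hypercyclicity set: a Furstenberg family containing pairwise disjoint sets
`A 1, A 2, …` such that distinct `j ∈ A k`, `j' ∈ A k'` satisfy `|j - j'| ≥ max k k'`
(the value `A 0` is irrelevant). -/
structure IsHypercyclicitySet (F : Set (Set ℕ)) : Prop where
  furstenberg : IsFurstenbergFamily F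
  exists_separated : ∃ A : ℕ → Set ℕ,
    (∀ k, 1 ≤ k → A k ∈ F) ∧
    (∀ k k', 1 ≤ k → 1 ≤ k' → k ≠ k' → Disjoint (A k) (A k')) ∧
    (∀ k k', 1 ≤ k → 1 ≤ k' → ∀ j ∈ A k, ∀ j' ∈ A k', j ≠ j' →
      ((max k k' : ℕ) : ℤ) ≤ |(j : ℤ) - (j' : ℤ)|)

/-- `F` is right-invariant: `E ∈ F` if and only if `p + E ∈ F` for every `p ∈ ℕ₀`. -/
def IsRightInvariant (F : Set (Set ℕ)) : Prop :=
  ∀ E : Set ℕ, E ∈ F ↔ ∀ p : ℕ, (fun n => p + n) '' E ∈ F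

/-- The complement of `F` in the power set of `ℕ₀` is closed under finite unions. -/
def ComplClosedUnderUnion (F : Set (Set ℕ)) : Prop :=
  ∀ E G : Set ℕ, E ∉ F → G ∉ F → E ∪ G ∉ F

/-- `N_T(Γ x, U) = {n : T^n (Γ x) ∩ U ≠ ∅}`. -/
def returnSet {X : Type u} [NormedAddCommGroup X] [NormedSpace ℂ X]
    (T : X →L[ℂ] X) (Γ : Set ℂ) (x : X) (U : Set X) : Set ℕ :=
  {n : ℕ | ((T ^ n) '' ((fun c : ℂ => c • x) '' Γ) ∩ U).Nonempty}

/-- `x` is an `F_Γ`-hypercyclic vector for `T`. -/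
def IsHypercyclicVector {X : Type u} [NormedAddCommGroup X] [NormedSpace ℂ X]
    (F : Set (Set ℕ)) (Γ : Set ℂ) (T : X →L[ℂ] X) (x : X) : Prop :=
  ∀ U : Set X, IsOpen U → U.Nonempty → returnSet T Γ x U ∈ F

/-- `Γ` is an `F`-hypercyclic scalar set: on every complex, separable, infinite-dimensional
Banach space, a vector is `F_Γ`-hypercyclic for an operator if and only if it is
`F_{1}`-hypercyclic for it. -/
def IsHypercyclicScalarSet (F : Set (Set ℕ)) (Γ : Set ℂ) : Prop :=
  ∀ (Y : Type u) [NormedAddCommGroup Y] [NormedSpace ℂ Y] [CompleteSpace Y]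
    [TopologicalSpace.SeparableSpace Y], ¬ FiniteDimensional ℂ Y →
    ∀ (S : Y →L[ℂ] Y) (y : Y),
      IsHypercyclicVector F Γ S y ↔ IsHypercyclicVector F {1} S y

/-- `A` is bounded away from zero. -/
def IsBoundedAwayFromZero (A : Set ℂ) : Prop :=
  ∃ ε : ℝ, 0 < ε ∧ ∀ z ∈ A, ε ≤ ‖z‖

/-- The sequences of (non-zero) elements of `Γ` whose moduli decrease to zero. The moduli
need not decrease strictly; when they do, the terms are automatically non-zero. -/
def decreasingNullSeqs (Γ : Set ℂ) : Set (ℕ → ℂ) :=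
  {α | (∀ k, α k ∈ Γ \ {0}) ∧ Antitone (fun k => ‖α k‖) ∧
    Filter.Tendsto (fun k => ‖α k‖) Filter.atTop (nhds 0)}

/-- The sequences in `Γ \ {0}` whose successive ratios of moduli tend to zero. -/
def ratioNullSeqs (Γ : Set ℂ) : Set (ℕ → ℂ) :=
  {α | (∀ k, α k ∈ Γ \ {0}) ∧
    Filter.Tendsto (fun k => ‖α (k + 1)‖ / ‖α k‖) Filter.atTop (nhds 0)}

/-! Sufficiency is a León–Müller type argument. Write R x z when z is a limit of the orbit of x
along F; this relation is closed, transitive, compatible with the commutant of T, and stable under z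
↦ T z. Compactness of an annulus and closure of the complement of F under unions give, for every y,
a scalar c in a fixed annulus with R x (c y) (`exists_isFamilyLimit`). To remove c, treat its
modulus and then its argument as a real parameter s, through e^{ωs} with ω = 1 or ω = I. The s with
R x (e^{ωs} x) form a closed, relatively dense subsemigroup of ℝ, so either ℝ, in which case s can
be removed, or aℤ with a > 0. In the second case s defines a continuous map g from the vectors
p(T)x, p ≠ 0, to ℝ/aℤ, with g(Ty) = g(y). The segments from x to Ty stay among these vectors, so g =
g ∘ T is null-homotopic and lifts to a real function Ψ (`forall_or_exists_lift`). For ω = I, a full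
turn changes Ψ by 2π but fixes the vector. For ω = 1, Ψ is monotone along the orbit of x, yet
unbounded in both directions on the orbit's closure.

Necessity comes from multiples of the backward shift on ℓ¹ and vectors pasted from blocks placed at
the times of the separated sets (`exists_scaled_returns`). If Γ ∖ {0} is unbounded, the contractive
shift itself becomes hypercyclic up to Γ. If some sequence in Γ ∖ {0} has moduli decreasing to 0,
adding a fixed vector of 16 • shift spoils hypercyclicity but is invisible after scaling. Hence a
hypercyclic scalar set admits no such sequence at all, and the ratio condition holds vacuously. -/

/-! ### Limit relation along a family -/

section LimitRelation

variable {X : Type u} [NormedAddCommGroup X] [NormedSpace ℂ X]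

/-- `z` is a limit of the orbit of `x` along `F`: the orbit visits each neighbourhood of `z` along
a set of times belonging to `F`. -/
def IsFamilyLimit (F : Set (Set ℕ)) (T : X →L[ℂ] X) (x z : X) : Prop :=
  ∀ U : Set X, IsOpen U → z ∈ U → {n : ℕ | (T ^ n) x ∈ U} ∈ F

theorem returnSet_singleton_one (T : X →L[ℂ] X) (x : X) (U : Set X) :
    returnSet T {1} x U = {n : ℕ | (T ^ n) x ∈ U} := by
  ext n
  simp [returnSet]

theorem isHypercyclicVector_one_iff {F : Set (Set ℕ)} {T : X →L[ℂ] X} {x : X} :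
    IsHypercyclicVector F {1} T x ↔ ∀ z, IsFamilyLimit F T x z := by
  simp only [IsHypercyclicVector, returnSet_singleton_one, IsFamilyLimit]
  exact ⟨fun h z U hU hz => h U hU ⟨z, hz⟩, fun h U hU ⟨z, hz⟩ => h z U hU hz⟩

/-- The properties of the relation that `z` is a limit of the orbit of `x` under `T`, on which the
covering argument rests. -/
structure IsOrbitRelation (T : X →L[ℂ] X) (R : X → X → Prop) : Prop where
  isClosed : ∀ x, IsClosed {z | R x z}
  trans : ∀ {x y z}, R x y → R y z → R x z
  map : ∀ (A : X →L[ℂ] X), Commute A T → ∀ {x z}, R x z → R (A x) (A z)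
  step : ∀ {x z}, R x z → R x (T z)

theorem IsOrbitRelation.smul {T : X →L[ℂ] X} {R : X → X → Prop} (h : IsOrbitRelation T R)
    (c : ℂ) {x z : X} (hxz : R x z) : R (c • x) (c • z) := by
  have := h.map (c • (1 : X →L[ℂ] X)) ((Commute.one_left T).smul_left c) hxz
  simpa using this

namespace IsFamilyLimit

variable {F : Set (Set ℕ)} {T : X →L[ℂ] X}

theorem isClosed (x : X) : IsClosed {z | IsFamilyLimit F T x z} := by
  rw [← isOpen_compl_iff, isOpen_iff_mem_nhds]
  intro z hz
  simp only [Set.mem_compl_iff, Set.mem_ofPred_eq, IsFamilyLimit, not_forall] at hz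
  obtain ⟨U, hU, hzU, hn⟩ := hz
  filter_upwards [hU.mem_nhds hzU] with w hw h
  exact hn (h U hU hw)

theorem mem_closure (hF : IsFurstenbergFamily F) {x z : X} (h : IsFamilyLimit F T x z) :
    z ∈ closure (Set.range fun n : ℕ => (T ^ n) x) := by
  rw [mem_closure_iff]
  intro U hU hz
  have hne : {n : ℕ | (T ^ n) x ∈ U}.Nonempty := by
    rw [Set.nonempty_iff_ne_empty]
    intro he
    exact hF.empty_notMem (he ▸ h U hU hz)
  obtain ⟨n, hn⟩ := hne
  exact ⟨_, hn, n, rfl⟩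

theorem step (hF : IsFurstenbergFamily F) (hr : IsRightInvariant F) {x z : X}
    (h : IsFamilyLimit F T x z) : IsFamilyLimit F T x (T z) := by
  intro U hU hz
  have h1 := (hr _).1 (h (T ⁻¹' U) (hU.preimage T.continuous) hz) 1
  refine hF.upward _ _ ?_ h1
  rintro _ ⟨n, hn, rfl⟩
  simp only [Set.mem_ofPred_eq, Set.mem_preimage] at hn ⊢
  rw [pow_add, pow_one]
  exact hn

/-- The limits of `x` form a closed `T`-invariant set, so with `y` they contain the closure of its
orbit. Together with `mem_closure` this gives transitivity. -/
theorem of_mem_closure (hF : IsFurstenbergFamily F) (hr : IsRightInvariant F) {x y z : X}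
    (h : IsFamilyLimit F T x y) (hz : z ∈ closure (Set.range fun n : ℕ => (T ^ n) y)) :
    IsFamilyLimit F T x z := by
  refine closure_minimal ?_ (isClosed (F := F) (T := T) x) hz
  rintro _ ⟨n, rfl⟩
  induction n with
  | zero => simpa using h
  | succ n ih =>
    have := step hF hr ih
    simpa [pow_succ'] using this

theorem map (hF : IsFurstenbergFamily F) (A : X →L[ℂ] X) (hA : Commute A T) {x z : X}
    (h : IsFamilyLimit F T x z) : IsFamilyLimit F T (A x) (A z) := by
  intro U hU hz
  refine hF.upward _ _ ?_ (h (A ⁻¹' U) (hU.preimage A.continuous) hz)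
  intro n hn
  have h1 : A ((T ^ n) x) = (T ^ n) (A x) := DFunLike.congr_fun (hA.pow_right n).eq x
  change (T ^ n) (A x) ∈ U
  rw [← h1]
  exact hn

theorem isOrbitRelation (hF : IsFurstenbergFamily F) (hr : IsRightInvariant F) :
    IsOrbitRelation T (IsFamilyLimit F T) where
  isClosed := isClosed
  trans h h' := of_mem_closure hF hr h (h'.mem_closure hF)
  map A hA _ _ h := h.map hF A hA
  step h := h.step hF hr

end IsFamilyLimit

theorem IsHypercyclicVector.of_one {F : Set (Set ℕ)} (hF : IsFurstenbergFamily F) {Γ : Set ℂ}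
    (hΓ : (Γ \ {0}).Nonempty) {T : X →L[ℂ] X} {x : X} (h : IsHypercyclicVector F {1} T x) :
    IsHypercyclicVector F Γ T x := by
  obtain ⟨c, hc, hc0⟩ := hΓ
  have hc0 : c ≠ 0 := hc0
  intro U hU hne
  obtain ⟨z, hz⟩ := hne
  have h1 := isHypercyclicVector_one_iff.1 h (c⁻¹ • z) ((fun v : X => c • v) ⁻¹' U)
    (hU.preimage (continuous_const_smul c)) (by simpa [smul_smul, hc0] using hz)
  refine hF.upward _ _ ?_ h1
  intro n hn
  exact ⟨(T ^ n) (c • x), ⟨c • x, ⟨c, hc, rfl⟩, rfl⟩, by simpa using hn⟩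

/-- The scalar 0 reaches only the zero vector, and every non-empty open set stays non-empty and open
when that vector is removed. -/
theorem IsHypercyclicVector.diff_zero [Nontrivial X] {F : Set (Set ℕ)}
    (hF : IsFurstenbergFamily F) {Γ : Set ℂ} {T : X →L[ℂ] X} {x : X}
    (h : IsHypercyclicVector F Γ T x) : IsHypercyclicVector F (Γ \ {0}) T x := by
  intro U hU hne
  have hne' : (U ∩ {0}ᶜ).Nonempty := by
    have := Module.punctured_nhds_neBot ℂ X
    exact (dense_compl_singleton (0 : X)).inter_open_nonempty U hU hne
  refine hF.upward _ _ ?_ (h _ (hU.inter isOpen_compl_singleton) hne')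
  rintro n ⟨_, ⟨_, ⟨c, hc, rfl⟩, rfl⟩, hcU, hc0⟩
  refine ⟨_, ⟨_, ⟨c, ⟨hc, ?_⟩, rfl⟩, rfl⟩, hcU⟩
  rintro rfl
  simp at hc0

/-- If the complement of `F` is closed under unions and the scalars lie in an annulus, then
every vector can be rescaled within the annulus to become a limit of the orbit along `F`. -/
theorem IsHypercyclicVector.exists_isFamilyLimit {F : Set (Set ℕ)}
    (hF : IsFurstenbergFamily F) (hc : ComplClosedUnderUnion F) {Γ : Set ℂ} {ε M : ℝ} (hε : 0 < ε)
    (hΓ : ∀ c ∈ Γ, ε ≤ ‖c‖ ∧ ‖c‖ ≤ M) {T : X →L[ℂ] X} {x : X}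
    (h : IsHypercyclicVector F Γ T x) (y : X) :
    ∃ c : ℂ, M⁻¹ ≤ ‖c‖ ∧ ‖c‖ ≤ ε⁻¹ ∧ IsFamilyLimit F T x (c • y) := by
  set K : Set ℂ := {c | M⁻¹ ≤ ‖c‖ ∧ ‖c‖ ≤ ε⁻¹} with hK
  have hKc : IsCompact K := by
    refine Metric.isCompact_of_isClosed_isBounded ?_ ?_
    · exact (isClosed_le continuous_const continuous_norm).inter
        (isClosed_le continuous_norm continuous_const)
    · exact isBounded_iff_forall_norm_le.2 ⟨ε⁻¹, fun c hc => hc.2⟩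
  by_contra! hcon
  -- If no `c • y` were a limit, finitely many open sets with visiting times outside `F` would cover
  -- the compact set `K • y`; their union still has visiting times outside `F`.
  have hcover : ∃ U : Set X, IsOpen U ∧ (fun c : ℂ => c • y) '' K ⊆ U ∧
      {n : ℕ | (T ^ n) x ∈ U} ∉ F := by
    refine (hKc.image (f := fun c : ℂ => c • y) (by fun_prop)).induction_on
      (p := fun s => ∃ U : Set X, IsOpen U ∧ s ⊆ U ∧ {n : ℕ | (T ^ n) x ∈ U} ∉ F) ?_ ?_ ?_ ?_
    · exact ⟨∅, isOpen_empty, subset_rfl, by simpa using hF.empty_notMem⟩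
    · rintro s t hst ⟨U, hU, htU, hn⟩
      exact ⟨U, hU, hst.trans htU, hn⟩
    · rintro s t ⟨U, hU, hsU, hn⟩ ⟨V, hV, htV, hn'⟩
      refine ⟨U ∪ V, hU.union hV, Set.union_subset_union hsU htV, ?_⟩
      exact hc _ _ hn hn'
    · rintro _ ⟨c, hcK, rfl⟩
      have := hcon c hcK.1 hcK.2
      simp only [IsFamilyLimit, not_forall] at this
      obtain ⟨U, hU, hyU, hn⟩ := this
      exact ⟨U, mem_nhdsWithin_of_mem_nhds (hU.mem_nhds hyU), U, hU, subset_rfl, hn⟩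
  obtain ⟨U, hU, hKU, hn⟩ := hcover
  -- A neighbourhood `W` of `y` satisfies `K • W ⊆ U`. A visit of the `Γ`-orbit to `W` with scalar
  -- `c` is then a visit of the plain orbit to `U`, since `c⁻¹ ∈ K`.
  obtain ⟨V, W, hV, hW, hKV, hyW, hVW⟩ := generalized_tube_lemma hKc (isCompact_singleton (x := y))
    (n := (fun q : ℂ × X => q.1 • q.2) ⁻¹' U) (hU.preimage continuous_smul) (by
      rintro ⟨c, v⟩ ⟨hc, hv⟩
      obtain rfl : v = y := hv
      exact hKU ⟨c, hc, rfl⟩)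
  refine hn (hF.upward _ _ ?_ (h W hW ⟨y, hyW rfl⟩))
  rintro n ⟨_, ⟨_, ⟨c, hc, rfl⟩, rfl⟩, hcW⟩
  have hcε := (hΓ c hc).1
  have hc0 : c ≠ 0 := by
    rintro rfl
    simp at hcε
    linarith
  have hcK : c⁻¹ ∈ K := by
    refine ⟨?_, ?_⟩
    · rw [norm_inv]
      exact inv_anti₀ (norm_pos_iff.2 hc0) (hΓ c hc).2
    · rw [norm_inv]
      exact inv_anti₀ hε hcε
  have := @hVW (c⁻¹, (T ^ n) (c • x)) ⟨hKV hcK, hcW⟩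
  simpa [smul_smul, hc0] using this

end LimitRelation

/-! ### Dense range of polynomials of an operator -/

section DenseRange

variable {X : Type u} [NormedAddCommGroup X] [NormedSpace ℂ X]

open Polynomial

theorem exists_functional_of_not_denseRange (A : X →L[ℂ] X) (h : ¬ DenseRange A) :
    ∃ f : X →L[ℂ] ℂ, f ≠ 0 ∧ ∀ v, f (A v) = 0 := by
  set S : Submodule ℂ X := (LinearMap.range A.toLinearMap).topologicalClosure with hS
  have hcl : IsClosed (S : Set X) := Submodule.isClosed_topologicalClosure _
  have hex : ∃ y, y ∉ S := by
    by_contra! hall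
    refine h fun y => ?_
    have := hall y
    rw [hS, ← SetLike.mem_coe, Submodule.topologicalClosure_coe, LinearMap.coe_range] at this
    exact this
  obtain ⟨y, hy⟩ := hex
  have hne : S.mkQ y ≠ 0 := by simpa using hy
  obtain ⟨f, hf⟩ := SeparatingDual.exists_ne_zero (R := ℂ) hne
  refine ⟨f.comp S.mkQL, fun h0 => hf ?_, fun v => ?_⟩
  · exact DFunLike.congr_fun h0 y
  · have : S.mkQ (A v) = 0 := by
      have : A v ∈ S := Submodule.le_topologicalClosure _ ⟨v, rfl⟩
      simpa using this
    change f (S.mkQ (A v)) = 0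
    rw [this, map_zero]

/-- An operator some orbit of which is dense up to scalars from an annulus has no eigenvalue of
its adjoint. -/
theorem denseRange_sub_of_orbit {T : X →L[ℂ] X} {x : X} {m M : ℝ} (hm : 0 < m)
    (h : ∀ y, ∃ c : ℂ, m ≤ ‖c‖ ∧ ‖c‖ ≤ M ∧ c • y ∈ closure (Set.range fun n : ℕ => (T ^ n) x))
    (μ : ℂ) : DenseRange (T - μ • (1 : X →L[ℂ] X)) := by
  by_contra hd
  obtain ⟨f, hf0, hf⟩ := exists_functional_of_not_denseRange _ hd
  have hTf : ∀ n : ℕ, f ((T ^ n) x) = μ ^ n * f x := by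
    intro n
    induction n with
    | zero => simp
    | succ n ih =>
      have := hf ((T ^ n) x)
      have h1 : f (T ((T ^ n) x)) - μ * f ((T ^ n) x) = 0 := by
        rw [← smul_eq_mul, ← map_smul, ← map_sub]
        exact this
      have h2 : (T ^ (n + 1)) x = T ((T ^ n) x) := by rw [pow_succ']; rfl
      rw [h2, sub_eq_zero.1 h1, ih]
      ring
  have hsurj : ∀ w : ℂ, ∃ y, f y = w := by
    obtain ⟨v, hv⟩ : ∃ v, f v ≠ 0 := by
      by_contra! hall
      exact hf0 (ContinuousLinearMap.ext hall)
    intro w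
    exact ⟨(w / f v) • v, by simp [hv]⟩
  -- If ‖μ‖ ≤ 1, `f` is bounded by ‖f x‖ on the orbit closure, which fails for `y` with `f y` large.
  -- If ‖μ‖ ≥ 1, it is bounded below by ‖f x‖; `y = 0` forces `f x = 0`, so `f` vanishes on the
  -- closure.
  rcases le_total ‖μ‖ 1 with hμ | hμ
  · obtain ⟨y, hy⟩ := hsurj (((‖f x‖ + 1) / m : ℝ) : ℂ)
    obtain ⟨c, hc, -, hcl⟩ := h y
    have hbd : ‖f (c • y)‖ ≤ ‖f x‖ := by
      refine closure_minimal (t := {v | ‖f v‖ ≤ ‖f x‖}) ?_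
        (isClosed_le (by fun_prop) continuous_const) hcl
      rintro _ ⟨n, rfl⟩
      simp only [Set.mem_ofPred_eq, hTf, norm_mul, norm_pow]
      exact mul_le_of_le_one_left (norm_nonneg _) (pow_le_one₀ (norm_nonneg _) hμ)
    rw [map_smul, hy, norm_smul, Complex.norm_real, Real.norm_of_nonneg (by positivity)] at hbd
    have : m * ((‖f x‖ + 1) / m) ≤ ‖c‖ * ((‖f x‖ + 1) / m) := by gcongr
    rw [mul_div_cancel₀ _ hm.ne'] at this
    linarith
  · have hbd : ∀ v ∈ closure (Set.range fun n : ℕ => (T ^ n) x), ‖f x‖ ≤ ‖f v‖ := by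
      intro v hv
      refine closure_minimal (t := {v | ‖f x‖ ≤ ‖f v‖}) ?_
        (isClosed_le continuous_const (by fun_prop)) hv
      rintro _ ⟨n, rfl⟩
      simp only [Set.mem_ofPred_eq, hTf, norm_mul, norm_pow]
      exact le_mul_of_one_le_left (norm_nonneg _) (one_le_pow₀ hμ)
    have hx0 : f x = 0 := by
      obtain ⟨c, -, -, hcl⟩ := h 0
      have := hbd _ hcl
      simpa using this
    obtain ⟨y, hy⟩ := hsurj 1
    obtain ⟨c, hc, -, hcl⟩ := h y
    have hz : f (c • y) = 0 := by
      refine closure_minimal (t := {v | f v = 0}) ?_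
        (isClosed_eq (by fun_prop) continuous_const) hcl
      rintro _ ⟨n, rfl⟩
      simp only [Set.mem_ofPred_eq, hTf, hx0, mul_zero]
    rw [map_smul, hy, smul_eq_mul, mul_one] at hz
    rw [hz, norm_zero] at hc
    linarith

theorem denseRange_aeval {T : X →L[ℂ] X} (h : ∀ μ : ℂ, DenseRange (T - μ • (1 : X →L[ℂ] X)))
    (p : ℂ[X]) (hp : p ≠ 0) : DenseRange (aeval T p) := by
  induction hn : p.natDegree using Nat.strong_induction_on generalizing p with
  | _ n ih =>
    by_cases hdeg : p.degree = 0
    · obtain ⟨c, hc⟩ : ∃ c, p = C c := ⟨_, eq_C_of_degree_eq_zero hdeg⟩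
      have hc0 : c ≠ 0 := by
        rintro rfl
        simp [hc] at hp
      refine Function.Surjective.denseRange fun y => ⟨c⁻¹ • y, ?_⟩
      simp [hc, Algebra.algebraMap_eq_smul_one, smul_smul, hc0]
    · obtain ⟨μ, hμ⟩ := IsAlgClosed.exists_root p hdeg
      obtain ⟨q, hq⟩ := dvd_iff_isRoot.2 hμ
      have hq0 : q ≠ 0 := by
        rintro rfl
        simp [hq] at hp
      have hdq : q.natDegree < n := by
        rw [← hn, hq, natDegree_mul (X_sub_C_ne_zero μ) hq0, natDegree_X_sub_C]
        omega
      have h1 := ih _ hdq q hq0 rfl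
      have h2 : aeval T p = (T - μ • (1 : X →L[ℂ] X)) * aeval T q := by
        rw [hq]
        simp [Algebra.algebraMap_eq_smul_one]
      rw [h2]
      exact (h μ).comp h1 (ContinuousLinearMap.continuous _)

theorem commute_aeval (T : X →L[ℂ] X) (p : ℂ[X]) : Commute (aeval T p) T := by
  have h : Commute (aeval T p) (aeval T (Polynomial.X : ℂ[X])) := by
    simp only [Commute, SemiconjBy, ← map_mul, mul_comm]
  simpa using h

end DenseRange

/-! ### Closed subsemigroups of the real line -/

/-- A Dirichlet-type argument: infinitely many combinations `p * t + q * r` lie in a compact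
interval, so some differences are nearly 0. Such a difference, with one `t` removed, is close to
`-t` and still has non-negative coefficients. -/
theorem neg_mem_of_isClosed_of_pos {S : Set ℝ} (hS : IsClosed S)
    (hadd : ∀ a ∈ S, ∀ b ∈ S, a + b ∈ S) {t r : ℝ} (ht : t ∈ S) (ht0 : 0 < t) (hr : r ∈ S)
    (hr0 : r < 0) : -t ∈ S := by
  have hmul : ∀ n : ℕ, ∀ a ∈ S, ((n + 1 : ℕ) : ℝ) * a ∈ S := by
    intro n a ha
    induction n with
    | zero => simpa using ha
    | succ n ih =>
      have := hadd _ ih _ ha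
      convert this using 1
      push_cast
      ring
  have hcomb : ∀ p q : ℕ, (p ≠ 0 ∨ q ≠ 0) → (p : ℝ) * t + q * r ∈ S := by
    intro p q hpq
    rcases p with _ | p
    · obtain ⟨q, rfl⟩ := Nat.exists_eq_succ_of_ne_zero (hpq.resolve_left (by simp))
      simpa using hmul q r hr
    · rcases q with _ | q
      · simpa using hmul p t ht
      · exact hadd _ (hmul p t ht) _ (hmul q r hr)
  let q : ℕ → ℕ := fun p => ⌈(p : ℝ) * t / (-r)⌉₊
  have hq : Monotone q := by
    intro a b hab
    refine Nat.ceil_mono ?_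
    have : (0 : ℝ) ≤ -r := by linarith
    gcongr
  have hbd : ∀ p : ℕ, (p : ℝ) * t + q p * r ∈ Set.Icc r 0 := by
    intro p
    have h1 : (p : ℝ) * t / (-r) ≤ q p := Nat.le_ceil _
    have h2 : (q p : ℝ) < (p : ℝ) * t / (-r) + 1 :=
      Nat.ceil_lt_add_one (div_nonneg (by positivity) (by linarith))
    rw [div_le_iff₀ (by linarith)] at h1
    rw [← sub_lt_iff_lt_add, lt_div_iff₀ (by linarith)] at h2
    constructor <;> nlinarith
  obtain ⟨l, -, φ, hφ, hlim⟩ := isCompact_Icc.tendsto_subseq hbd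
  have hdiff := (hlim.comp (Filter.tendsto_add_atTop_nat 1)).sub hlim
  rw [sub_self] at hdiff
  have hdiff' := hdiff.sub_const t
  rw [zero_sub] at hdiff'
  -- The coefficient of `t` strictly increases with `j`, so one copy can be spared. The point 0 is
  -- adjoined because the empty combination is not known to lie in `S`.
  have hmem : ∀ j, ((φ (j + 1) : ℝ) * t + q (φ (j + 1)) * r) - ((φ j : ℝ) * t + q (φ j) * r) - t
      ∈ S ∪ {0} := by
    intro j
    have h1 : φ j < φ (j + 1) := hφ (Nat.lt_succ_self j)
    have h2 : q (φ j) ≤ q (φ (j + 1)) := hq h1.le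
    obtain ⟨d, hd⟩ := Nat.exists_eq_add_of_lt h1
    obtain ⟨e, he⟩ := Nat.exists_eq_add_of_le h2
    have heq : ((φ (j + 1) : ℝ) * t + q (φ (j + 1)) * r) - ((φ j : ℝ) * t + q (φ j) * r) - t
        = d * t + e * r := by
      rw [he, hd]
      push_cast
      ring
    rw [heq]
    by_cases h0 : d ≠ 0 ∨ e ≠ 0
    · exact Or.inl (hcomb d e h0)
    · push Not at h0
      simp [h0.1, h0.2]
  have := (hS.union isClosed_singleton).mem_of_tendsto hdiff' (Filter.Eventually.of_forall hmem)
  rcases this with h | h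
  · exact h
  · simp at h
    linarith

/-- Relative density supplies an element of `S` of the opposite sign: shifting by ±(M + 1) outweighs
any `s` in `[-M, M]`. -/
theorem neg_mem_of_isClosed_of_relativelyDense {S : Set ℝ} (hS : IsClosed S)
    (hadd : ∀ a ∈ S, ∀ b ∈ S, a + b ∈ S) {M : ℝ}
    (hM : ∀ t : ℝ, ∃ s ∈ Set.Icc (-M) M, s + t ∈ S) {t : ℝ} (ht : t ∈ S) : -t ∈ S := by
  rcases lt_trichotomy t 0 with h | h | h
  · obtain ⟨s, hs, hsS⟩ := hM (M + 1)
    have := neg_mem_of_isClosed_of_pos (S := -S) (t := -t) (r := -(s + (M + 1))) hS.neg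
      (fun a ha b hb => by
        have := hadd _ ha _ hb
        rw [Set.mem_neg]
        convert this using 1
        ring)
      (by simpa using ht) (by linarith) (by rw [Set.mem_neg, neg_neg]; exact hsS)
      (by have := hs.1; linarith)
    simpa using this
  · simpa [h] using ht
  · obtain ⟨s, hs, hsS⟩ := hM (-(M + 1))
    exact neg_mem_of_isClosed_of_pos hS hadd ht h hsS (by have := hs.2; linarith)

/-- A closed, relatively dense subsemigroup of the line is the line or is generated by one positive
number. -/
theorem eq_univ_or_eq_zmultiples_of_isClosed {S : Set ℝ} (hS : IsClosed S)
    (hadd : ∀ a ∈ S, ∀ b ∈ S, a + b ∈ S) {M : ℝ}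
    (hM : ∀ t : ℝ, ∃ s ∈ Set.Icc (-M) M, s + t ∈ S) :
    S = Set.univ ∨ ∃ a : ℝ, 0 < a ∧ S = AddSubgroup.zmultiples a := by
  have hneg : ∀ t ∈ S, -t ∈ S := fun t => neg_mem_of_isClosed_of_relativelyDense hS hadd hM
  have hzero : (0 : ℝ) ∈ S := by
    obtain ⟨s, -, hs⟩ := hM 0
    simpa using hadd _ hs _ (hneg _ hs)
  let G : AddSubgroup ℝ :=
    { carrier := S
      add_mem' := fun ha hb => hadd _ ha _ hb
      zero_mem' := hzero
      neg_mem' := fun ha => hneg _ ha }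
  have hGS : (G : Set ℝ) = S := rfl
  rcases G.dense_or_cyclic with hd | ⟨a, ha⟩
  · left
    rw [← hGS, ← hd.closure_eq, hGS, hS.closure_eq]
  · right
    rw [← AddSubgroup.zmultiples_eq_closure] at ha
    have ha0 : a ≠ 0 := by
      rintro rfl
      obtain ⟨s, hs, hsS⟩ := hM (M + 1)
      rw [← hGS, ha] at hsS
      simp at hsS
      have := hs.1
      linarith
    rcases lt_or_gt_of_ne ha0 with h | h
    · exact ⟨-a, by linarith, by rw [AddSubgroup.zmultiples_neg, ← ha, hGS]⟩
    · exact ⟨a, h, by rw [← ha, hGS]⟩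

/-! ### Lifting the phase of an orbit relation -/

section Lifting

open Polynomial

variable {X : Type u} [NormedAddCommGroup X] [NormedSpace ℂ X]

/-- The vectors `p(T) x` with `p` a non-zero polynomial. -/
def polyOrbit (T : X →L[ℂ] X) (x : X) : Set X :=
  {y | ∃ p : ℂ[X], p ≠ 0 ∧ aeval T p x = y}

theorem self_mem_polyOrbit (T : X →L[ℂ] X) (x : X) : x ∈ polyOrbit T x :=
  ⟨1, one_ne_zero, by simp⟩

theorem smul_mem_polyOrbit {T : X →L[ℂ] X} {x y : X} (hy : y ∈ polyOrbit T x) {c : ℂ}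
    (hc : c ≠ 0) : c • y ∈ polyOrbit T x := by
  obtain ⟨p, hp, rfl⟩ := hy
  exact ⟨c • p, smul_ne_zero hc hp, by simp⟩

/-- These combinations supply the homotopy from the constant map `x` to `T` inside `polyOrbit T x`.
The polynomial is non-zero because its constant term is `1 - s`, and for `s = 1` it is `X * p`. -/
theorem segment_mem_polyOrbit {T : X →L[ℂ] X} {x y : X} (hy : y ∈ polyOrbit T x) (s : ℂ) :
    s • T y + (1 - s) • x ∈ polyOrbit T x := by
  obtain ⟨p, hp, rfl⟩ := hy
  refine ⟨s • (Polynomial.X * p) + C (1 - s), ?_, ?_⟩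
  · intro h0
    have h1 : 1 - s = 0 := by
      have := congrArg (fun q => coeff q 0) h0
      simpa using this
    have hs : s = 1 := (sub_eq_zero.1 h1).symm
    rw [hs] at h0
    simp [hp] at h0
  · simp [Algebra.algebraMap_eq_smul_one, sub_smul]

theorem apply_mem_polyOrbit {T : X →L[ℂ] X} {x y : X} (hy : y ∈ polyOrbit T x) :
    T y ∈ polyOrbit T x := by
  simpa using segment_mem_polyOrbit hy 1

theorem pow_apply_mem_polyOrbit (T : X →L[ℂ] X) (x : X) (n : ℕ) :
    (T ^ n) x ∈ polyOrbit T x :=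
  ⟨Polynomial.X ^ n, pow_ne_zero _ X_ne_zero, by simp⟩

/-- Projection along a compact interval is a closed map. The constraint set `C` serves for the
continuity of the phase modulo `a`. -/
theorem isClosed_setOf_exists_smul {P : X → Prop} (hP : IsClosed {z | P z}) (ω : ℂ) (M : ℝ)
    {C : Set ℝ} (hC : IsClosed C) :
    IsClosed {v : X | ∃ s ∈ Set.Icc (-M) M, s ∈ C ∧ P (Complex.exp (ω * s) • v)} := by
  have h1 : IsClosed {q : X × Set.Icc (-M) M |
      (q.2 : ℝ) ∈ C ∧ P (Complex.exp (ω * (q.2 : ℝ)) • q.1)} := by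
    refine IsClosed.inter (hC.preimage (by fun_prop)) (hP.preimage (f := fun q : X × Set.Icc (-M) M =>
      Complex.exp (ω * (q.2 : ℝ)) • q.1) (by fun_prop))
  have h2 := isClosedMap_fst_of_compactSpace _ h1
  convert h2 using 1
  ext v
  simp only [Set.mem_ofPred_eq, Set.mem_image, Prod.exists, Subtype.exists]
  constructor
  · rintro ⟨s, hs, hC, hP⟩
    exact ⟨v, s, hs, ⟨hC, hP⟩, rfl⟩
  · rintro ⟨v', s, hs, ⟨hC, hP⟩, rfl⟩
    exact ⟨s, hs, hC, hP⟩

namespace IsOrbitRelation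

variable {T : X →L[ℂ] X} {R : X → X → Prop}

/-- Applying `p(T)` to the relations at `x` settles every `z` in the range of `p(T)`, which is
dense; compactness of the parameter interval passes to the closure. In particular one can return
from `y` to `x`. -/
theorem exists_smul_of_mem_polyOrbit (hR : IsOrbitRelation T R) {x : X} {ω : ℂ} {M : ℝ}
    (hcov : ∀ y, ∃ s ∈ Set.Icc (-M) M, R x (Complex.exp (ω * (s : ℝ)) • y))
    (hT : ∀ p : ℂ[X], p ≠ 0 → DenseRange (aeval T p)) {y : X} (hy : y ∈ polyOrbit T x) (z : X) :
    ∃ s ∈ Set.Icc (-M) M, R y (Complex.exp (ω * (s : ℝ)) • z) := by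
  obtain ⟨p, hp, rfl⟩ := hy
  have hcl := isClosed_setOf_exists_smul (hR.isClosed (aeval T p x)) ω M isClosed_univ
  have hz := closure_minimal (s := Set.range (aeval T p)) ?_ hcl (hT p hp z)
  · obtain ⟨s, hs, -, h⟩ := hz
    exact ⟨s, hs, h⟩
  · rintro _ ⟨v, rfl⟩
    obtain ⟨s, hs, h⟩ := hcov v
    refine ⟨s, hs, Set.mem_univ _, ?_⟩
    have := hR.map _ (commute_aeval T p) h
    simpa using this

theorem trans_exp_smul (hR : IsOrbitRelation T R) {x y z : X} {ω : ℂ} {s t : ℝ}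
    (h : R x (Complex.exp (ω * s) • y)) (h' : R y (Complex.exp (ω * t) • z)) :
    R x (Complex.exp (ω * ((s + t : ℝ) : ℂ)) • z) := by
  have := hR.trans h (hR.smul (Complex.exp (ω * s)) h')
  rwa [smul_smul, ← Complex.exp_add, ← mul_add, ← Complex.ofReal_add] at this

/-- Either every vector is related to `x`, or the phase that relates a vector of the polynomial
orbit to `x` is unique up to a discrete group and has a continuous determination. -/
theorem forall_or_exists_lift (hR : IsOrbitRelation T R) {x : X} {ω : ℂ} {M : ℝ}
    (hcov : ∀ y, ∃ s ∈ Set.Icc (-M) M, R x (Complex.exp (ω * (s : ℝ)) • y))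
    (hT : ∀ p : ℂ[X], p ≠ 0 → DenseRange (aeval T p)) :
    (∀ y, R x y) ∨ ∃ a : ℝ, 0 < a ∧
      (∀ y ∈ polyOrbit T x, ∀ s t : ℝ, R x (Complex.exp (ω * s) • y) →
        R x (Complex.exp (ω * t) • y) → ∃ n : ℤ, s - t = n * a) ∧
      ∃ Ψ : C(polyOrbit T x, ℝ), ∀ y : polyOrbit T x,
        R x (Complex.exp (ω * (Ψ y : ℝ)) • (y : X)) := by
  set S : Set ℝ := {t : ℝ | R x (Complex.exp (ω * t) • x)} with hSdef
  have hScl : IsClosed S := (hR.isClosed x).preimage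
    (f := fun t : ℝ => Complex.exp (ω * t) • x) (by fun_prop)
  have hSadd : ∀ a ∈ S, ∀ b ∈ S, a + b ∈ S := fun a ha b hb => hR.trans_exp_smul ha hb
  have hSM : ∀ t : ℝ, ∃ s ∈ Set.Icc (-M) M, s + t ∈ S := by
    intro t
    obtain ⟨s, hs, h⟩ := hcov (Complex.exp (ω * t) • x)
    refine ⟨s, hs, ?_⟩
    rwa [smul_smul, ← Complex.exp_add, ← mul_add, ← Complex.ofReal_add] at h
  have hSneg : ∀ t ∈ S, -t ∈ S :=
    fun t => neg_mem_of_isClosed_of_relativelyDense hScl hSadd hSM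
  -- A phase `τ` leading from `y` back to `x` puts both `s + τ` and `t + τ` in `S`, which is a
  -- group.
  have hcoset : ∀ y ∈ polyOrbit T x, ∀ s t : ℝ, R x (Complex.exp (ω * s) • y) →
      R x (Complex.exp (ω * t) • y) → s - t ∈ S := by
    intro y hy s t hs ht
    obtain ⟨τ, -, hτ⟩ := hR.exists_smul_of_mem_polyOrbit hcov hT hy x
    have h1 : s + τ ∈ S := hR.trans_exp_smul hs hτ
    have h2 : t + τ ∈ S := hR.trans_exp_smul ht hτ
    have := hSadd _ h1 _ (hSneg _ h2)
    convert this using 1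
    ring
  rcases eq_univ_or_eq_zmultiples_of_isClosed hScl hSadd hSM with hS | ⟨a, ha, hS⟩
  · left
    intro y
    obtain ⟨s, -, hs⟩ := hcov y
    have h1 : -s ∈ S := hS ▸ Set.mem_univ _
    have := hR.trans_exp_smul h1 hs
    simpa using this
  · right
    have hmem : ∀ t : ℝ, t ∈ S ↔ ∃ n : ℤ, t = n * a := by
      intro t
      rw [hS, SetLike.mem_coe, AddSubgroup.mem_zmultiples_iff]
      simp only [zsmul_eq_mul, eq_comm]
    refine ⟨a, ha, fun y hy s t hs ht => (hmem _).1 (hcoset y hy s t hs ht), ?_⟩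
    have : Fact (0 < a) := ⟨ha⟩
    choose σ hσM hσ using hcov
    let g : polyOrbit T x → AddCircle a := fun y => (σ y : ℝ)
    have hg : ∀ (y : polyOrbit T x) (t : ℝ), g y = t ↔ R x (Complex.exp (ω * t) • (y : X)) := by
      intro y t
      have hiff : g y = t ↔ t - σ y ∈ S := by
        change ((σ y : ℝ) : AddCircle a) = t ↔ _
        rw [eq_comm, ← sub_eq_zero, ← AddCircle.coe_sub, AddCircle.coe_eq_zero_iff, hmem]
        simp only [zsmul_eq_mul, eq_comm]
      rw [hiff]
      constructor
      · intro h
        have := hR.trans_exp_smul h (hσ y)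
        simpa using this
      · intro h
        exact hcoset y y.2 _ _ h (hσ y)
    have hgc : Continuous g := by
      rw [continuous_iff_isClosed]
      intro C hC
      have h1 := (isClosed_setOf_exists_smul (hR.isClosed x) ω M
        (hC.preimage (AddCircle.continuous_mk' a))).preimage
          (continuous_subtype_val (p := fun y => y ∈ polyOrbit T x))
      convert h1 using 1
      ext y
      simp only [Set.mem_preimage, Set.mem_ofPred_eq]
      constructor
      · intro h
        exact ⟨σ y, hσM y, h, hσ y⟩
      · rintro ⟨s, -, hs, h⟩
        rw [(hg y s).2 h]
        exact hs
    -- A phase valid for `y` is valid for `T y`, by the step property.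
    have hgT : ∀ y : polyOrbit T x, g ⟨T y, apply_mem_polyOrbit y.2⟩ = g y := by
      intro y
      refine (hg _ (σ y)).2 ?_
      have := hR.step (hσ y)
      simpa using this
    let h : unitInterval × polyOrbit T x → polyOrbit T x := fun q =>
      ⟨(((q.1 : ℝ) : ℂ)) • T q.2 + (1 - ((q.1 : ℝ) : ℂ)) • x, segment_mem_polyOrbit q.2.2 _⟩
    have hh : Continuous h := by
      refine Continuous.subtype_mk ?_ _
      fun_prop
    -- This homotopy runs from the constant `g x` to `g ∘ T = g`. The constant lifts to ℝ, hence so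
    -- does the whole homotopy, and its end is the desired lift of `g`.
    let H : C(unitInterval × polyOrbit T x, AddCircle a) := ⟨fun q => g (h q), hgc.comp hh⟩
    let f : C(polyOrbit T x, ℝ) := ContinuousMap.const _ (σ x)
    have hH0 : ∀ y, H (0, y) = ((f y : ℝ) : AddCircle a) := by
      intro y
      have : h (0, y) = ⟨x, self_mem_polyOrbit T x⟩ := by
        apply Subtype.ext
        simp [h]
      change g (h (0, y)) = _
      rw [this]
      rfl
    have cov := AddCircle.isCoveringMap_coe a
    let L := cov.liftHomotopy H f hH0
    refine ⟨⟨fun y => L (1, y), by fun_prop⟩, fun y => ?_⟩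
    rw [← hg]
    have h1 : ((L (1, y) : ℝ) : AddCircle a) = H (1, y) :=
      congrFun (cov.liftHomotopy_lifts H f hH0) (1, y)
    change g y = ((L (1, y) : ℝ) : AddCircle a)
    rw [h1, ← hgT y]
    change _ = g (h (1, y))
    congr 1
    apply Subtype.ext
    simp [h]

end IsOrbitRelation

/-- Two distinct values would, by the intermediate value theorem, force a value (n + 1/2)a. -/
theorem eq_of_forall_exists_int_mul {Y : Type*} [TopologicalSpace Y] [PreconnectedSpace Y]
    {f : Y → ℝ} (hf : Continuous f) {a : ℝ} (ha : 0 < a) (h : ∀ y, ∃ n : ℤ, f y = n * a)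
    (y z : Y) : f y = f z := by
  have hlt : ∀ y z, ¬ f y < f z := by
    intro y z hyz
    obtain ⟨n, hn⟩ := h y
    obtain ⟨m, hm⟩ := h z
    have hnm : n + 1 ≤ m := by
      rw [hn, hm] at hyz
      have : (n : ℝ) < m := lt_of_mul_lt_mul_right hyz ha.le
      exact_mod_cast this
    have hnm' : (n : ℝ) + 1 ≤ m := by exact_mod_cast hnm
    obtain ⟨w, hw⟩ := mem_range_of_exists_le_of_exists_ge (c := (n + 1 / 2 : ℝ) * a) hf
      ⟨y, by rw [hn]; nlinarith⟩ ⟨z, by rw [hm]; nlinarith⟩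
    obtain ⟨k, hk⟩ := h w
    rw [hk] at hw
    have hk' := mul_right_cancel₀ ha.ne' hw
    have h2 : ((2 * k : ℤ) : ℝ) = ((2 * n + 1 : ℤ) : ℝ) := by push_cast; linarith
    have h3 : 2 * k = 2 * n + 1 := by exact_mod_cast h2
    omega
  exact le_antisymm (not_lt.1 (hlt z y)) (not_lt.1 (hlt y z))

end Lifting

/-! ### Removing the modulus and the argument of the scalar -/

section ScalarSet

open Polynomial

variable {X : Type u} [NormedAddCommGroup X] [NormedSpace ℂ X]

namespace IsOrbitRelation

variable {T : X →L[ℂ] X} {R : X → X → Prop}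

/-- Forgetting unimodular factors preserves orbit relations. -/
theorem circle (hR : IsOrbitRelation T R) :
    IsOrbitRelation T (fun x z => ∃ u : Circle, R x ((u : ℂ) • z)) where
  isClosed x := by
    have h1 : IsClosed {q : X × Circle | R x ((q.2 : ℂ) • q.1)} :=
      (hR.isClosed x).preimage (f := fun q : X × Circle => (q.2 : ℂ) • q.1) (by fun_prop)
    convert isClosedMap_fst_of_compactSpace _ h1 using 1
    ext v
    simp
  trans := by
    rintro x y z ⟨u, hu⟩ ⟨v, hv⟩
    refine ⟨u * v, ?_⟩
    have := hR.trans hu (hR.smul (u : ℂ) hv)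
    rwa [smul_smul, ← Circle.coe_mul] at this
  map := by
    rintro A hA x z ⟨u, hu⟩
    exact ⟨u, by simpa using hR.map A hA hu⟩
  step := by
    rintro x z ⟨u, hu⟩
    exact ⟨u, by simpa using hR.step hu⟩

/-- A continuous phase is equivariant under the one-parameter group it lifts. -/
theorem lift_exp_smul {x : X} {ω : ℂ} {a : ℝ} (ha : 0 < a)
    (huniq : ∀ y ∈ polyOrbit T x, ∀ s t : ℝ, R x (Complex.exp (ω * s) • y) →
      R x (Complex.exp (ω * t) • y) → ∃ n : ℤ, s - t = n * a)
    (Ψ : C(polyOrbit T x, ℝ))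
    (hΨ : ∀ y : polyOrbit T x, R x (Complex.exp (ω * (Ψ y : ℝ)) • (y : X)))
    (y : polyOrbit T x) (t : ℝ) :
    Ψ ⟨Complex.exp (ω * t) • (y : X), smul_mem_polyOrbit y.2 (Complex.exp_ne_zero _)⟩
      = Ψ y - t := by
  let e : ℝ → polyOrbit T x := fun t =>
    ⟨Complex.exp (ω * t) • (y : X), smul_mem_polyOrbit y.2 (Complex.exp_ne_zero _)⟩
  have he : Continuous e := Continuous.subtype_mk (by fun_prop) _
  have he0 : e 0 = y := Subtype.ext (by simp [e])
  -- Both `Ψ (e t) + t` and `Ψ y` are phases of `y`, so they differ by a multiple of `a`, constant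
  -- in `t` by connectedness.
  have hconst := eq_of_forall_exists_int_mul (f := fun t => Ψ (e t) + t - Ψ y) (by fun_prop) ha
    (fun t => huniq y y.2 _ _ (by
      have := hΨ (e t)
      rwa [show ((e t : polyOrbit T x) : X) = Complex.exp (ω * t) • (y : X) from rfl, smul_smul,
        ← Complex.exp_add, ← mul_add, ← Complex.ofReal_add] at this) (hΨ y)) t 0
  simp only [he0] at hconst
  change Ψ (e t) = _
  linarith

/-- If every vector is related to `x` up to a unimodular factor, then every vector is related
to `x`. -/
theorem forall_of_circle (hR : IsOrbitRelation T R) {x : X}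
    (hT : ∀ p : ℂ[X], p ≠ 0 → DenseRange (aeval T p))
    (h : ∀ y, ∃ u : Circle, R x ((u : ℂ) • y)) (y : X) : R x y := by
  have hcov : ∀ y, ∃ s ∈ Set.Icc (-Real.pi) Real.pi,
      R x (Complex.exp (Complex.I * (s : ℝ)) • y) := by
    intro y
    obtain ⟨u, hu⟩ := h y
    refine ⟨Complex.arg u, ⟨(Complex.neg_pi_lt_arg _).le, Complex.arg_le_pi _⟩, ?_⟩
    have h1 : Complex.exp (Complex.I * (Complex.arg u : ℝ)) = u := by
      have := Complex.norm_mul_exp_arg_mul_I (u : ℂ)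
      rwa [Circle.norm_coe, Complex.ofReal_one, one_mul, mul_comm] at this
    rwa [h1]
  rcases hR.forall_or_exists_lift hcov hT with hall | ⟨a, ha, huniq, Ψ, hΨ⟩
  · exact hall y
  · exfalso
    have h1 := lift_exp_smul ha huniq Ψ hΨ ⟨x, self_mem_polyOrbit T x⟩ (2 * Real.pi)
    have h2 : Complex.exp (Complex.I * ((2 * Real.pi : ℝ) : ℂ)) = 1 := by
      rw [mul_comm]
      push_cast
      exact Complex.exp_two_pi_mul_I
    simp only [h2, one_smul] at h1
    linarith [Real.pi_pos]

/-- If every vector is related to `x` up to a factor from an annulus, then every vector is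
related to `x` up to a unimodular factor. -/
theorem exists_circle_of_annulus (hR : IsOrbitRelation T R) {x : X}
    (hT : ∀ p : ℂ[X], p ≠ 0 → DenseRange (aeval T p))
    (hcl : ∀ z, R x z → z ∈ closure (Set.range fun n : ℕ => (T ^ n) x)) {m M : ℝ} (hm : 0 < m)
    (h : ∀ y, ∃ c : ℂ, m ≤ ‖c‖ ∧ ‖c‖ ≤ M ∧ R x (c • y)) (y : X) :
    ∃ u : Circle, R x ((u : ℂ) • y) := by
  -- `N` bounds |log ‖c‖| on the annulus: the scalar is written as `e^s u` with `s = log ‖c‖` and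
  -- `u` unimodular.
  set N : ℝ := max (Real.log M) (-Real.log m) with hN
  have hcov : ∀ y, ∃ s ∈ Set.Icc (-N) N, ∃ u : Circle,
      R x ((u : ℂ) • Complex.exp ((1 : ℂ) * (s : ℝ)) • y) := by
    intro y
    obtain ⟨c, hc1, hc2, hc⟩ := h y
    have hc0 : 0 < ‖c‖ := hm.trans_le hc1
    refine ⟨Real.log ‖c‖, ⟨?_, ?_⟩, Circle.exp (Complex.arg c), ?_⟩
    · have h1 := Real.log_le_log hm hc1
      have h2 : -Real.log m ≤ N := le_max_right _ _
      linarith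
    · exact (Real.log_le_log hc0 hc2).trans (le_max_left _ _)
    · rw [smul_smul, Circle.coe_exp, one_mul, ← Complex.ofReal_exp, Real.exp_log hc0, mul_comm,
        Complex.norm_mul_exp_arg_mul_I]
      exact hc
  have hR' := hR.circle
  rcases hR'.forall_or_exists_lift hcov hT with hall | ⟨a, ha, huniq, Ψ, hΨ⟩
  · exact hall y
  exfalso
  have hexp := lift_exp_smul (R := fun x z => ∃ u : Circle, R x ((u : ℂ) • z)) ha huniq Ψ hΨ
  have hcirc : ∀ (y : polyOrbit T x) (u : Circle),
      Ψ ⟨(u : ℂ) • (y : X), smul_mem_polyOrbit y.2 (Circle.coe_ne_zero u)⟩ = Ψ y := by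
    intro y u
    let e : ℝ → polyOrbit T x := fun θ =>
      ⟨(Circle.exp θ : ℂ) • (y : X), smul_mem_polyOrbit y.2 (Circle.coe_ne_zero _)⟩
    have he : Continuous e := Continuous.subtype_mk (by fun_prop) _
    have he0 : e 0 = y := Subtype.ext (by simp [e])
    have heu : e (Complex.arg u) = ⟨(u : ℂ) • (y : X), smul_mem_polyOrbit y.2 (Circle.coe_ne_zero u)⟩ :=
      Subtype.ext (by simp [e])
    have hconst := eq_of_forall_exists_int_mul (f := fun θ => Ψ (e θ) - Ψ y) (by fun_prop) ha
      (fun θ => huniq y y.2 _ _ (by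
        obtain ⟨v, hv⟩ := hΨ (e θ)
        refine ⟨v * Circle.exp θ, ?_⟩
        rw [Circle.coe_mul, mul_smul, smul_comm (Circle.exp θ : ℂ)]
        exact hv) (hΨ y)) (Complex.arg u) 0
    simp only [he0, heu] at hconst
    linarith
  let x₀ : polyOrbit T x := ⟨x, self_mem_polyOrbit T x⟩
  let τ : polyOrbit T x → polyOrbit T x := fun y => ⟨T y, apply_mem_polyOrbit y.2⟩
  have hτ : Continuous τ := Continuous.subtype_mk (by fun_prop) _
  have hδ : ∀ y, ∃ n : ℤ, Ψ (τ y) - Ψ y = n * a := by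
    intro y
    refine huniq (τ y) (τ y).2 _ _ (hΨ _) ?_
    have := hR'.step (hΨ y)
    rwa [map_smul] at this
  -- The increment of `Ψ` under `T` takes values in `aℤ`, hence is constant on the segment from `x`
  -- to `T y`.
  have hδT : ∀ y, Ψ (τ (τ y)) - Ψ (τ y) = Ψ (τ x₀) - Ψ x₀ := by
    intro y
    let e : ℝ → polyOrbit T x := fun s =>
      ⟨(s : ℂ) • T y + (1 - (s : ℂ)) • x, segment_mem_polyOrbit y.2 _⟩
    have he : Continuous e := Continuous.subtype_mk (by fun_prop) _
    have he0 : e 0 = x₀ := Subtype.ext (by simp [e, x₀])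
    have he1 : e 1 = τ y := Subtype.ext (by simp [e, τ])
    have := eq_of_forall_exists_int_mul (f := fun s => Ψ (τ (e s)) - Ψ (e s)) (by fun_prop) ha
      (fun s => hδ (e s)) 1 0
    simpa only [he0, he1] using this
  set b := Ψ (τ x₀) - Ψ x₀ with hb
  let o : ℕ → polyOrbit T x := fun n => ⟨(T ^ n) x, pow_apply_mem_polyOrbit T x n⟩
  have hos : ∀ n, o (n + 1) = τ (o n) := by
    intro n
    apply Subtype.ext
    simp only [o, τ, pow_succ']
    rfl
  have ho0 : o 0 = x₀ := Subtype.ext (by simp [o, x₀])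
  have hstep : ∀ n, Ψ (o (n + 1)) = Ψ (o n) + b := by
    intro n
    rcases n with _ | n
    · rw [hos, ho0]
      linarith
    · have := hδT (o n)
      rw [hos, hos n]
      linarith
  have ho : ∀ n : ℕ, Ψ (o n) = Ψ x₀ + n * b := by
    intro n
    induction n with
    | zero => simp [ho0]
    | succ n ih =>
      rw [hstep, ih]
      push_cast
      ring
  -- Covering the vector `e^t x` gives a point `u e^(s+t) x` of the orbit closure, where `Ψ` differs
  -- from `Ψ x₀ - t` by at most `N`.
  have hmain : ∀ t : ℝ, ∃ s ∈ Set.Icc (-N) N, ∃ w : polyOrbit T x, w ∈ closure (Set.range o) ∧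
      Ψ w = Ψ x₀ - t - s := by
    intro t
    let z : polyOrbit T x := ⟨Complex.exp ((1 : ℂ) * t) • (x₀ : X),
      smul_mem_polyOrbit x₀.2 (Complex.exp_ne_zero _)⟩
    obtain ⟨s, hs, u, hu⟩ := hcov z
    let z' : polyOrbit T x := ⟨Complex.exp ((1 : ℂ) * s) • (z : X),
      smul_mem_polyOrbit z.2 (Complex.exp_ne_zero _)⟩
    refine ⟨s, hs, ⟨(u : ℂ) • (z' : X), smul_mem_polyOrbit z'.2 (Circle.coe_ne_zero u)⟩, ?_, ?_⟩
    · rw [closure_subtype, ← Set.range_comp]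
      exact hcl _ hu
    · rw [hcirc z' u, hexp z s, hexp x₀ t]
  -- According to the sign of `b`, `Ψ` is bounded below or above by `Ψ x₀` on the orbit closure; `t
  -- = ±(N + 1)` violates the bound.
  rcases le_total 0 b with hb0 | hb0
  · obtain ⟨s, hs, w, hw, hΨw⟩ := hmain (N + 1)
    have : Ψ x₀ ≤ Ψ w := by
      refine closure_minimal (t := {w | Ψ x₀ ≤ Ψ w}) ?_
        (isClosed_le continuous_const Ψ.continuous) hw
      rintro _ ⟨n, rfl⟩
      simp only [Set.mem_ofPred_eq, ho]
      have : (0 : ℝ) ≤ n * b := by positivity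
      linarith
    linarith [hs.1]
  · obtain ⟨s, hs, w, hw, hΨw⟩ := hmain (-(N + 1))
    have : Ψ w ≤ Ψ x₀ := by
      refine closure_minimal (t := {w | Ψ w ≤ Ψ x₀}) ?_
        (isClosed_le Ψ.continuous continuous_const) hw
      rintro _ ⟨n, rfl⟩
      simp only [Set.mem_ofPred_eq, ho]
      have : (n : ℝ) * b ≤ 0 := mul_nonpos_of_nonneg_of_nonpos (by positivity) hb0
      linarith
    linarith [hs.2]

end IsOrbitRelation

end ScalarSet

/-! ### Sufficiency for scalars in an annulus -/

theorem isHypercyclicScalarSet_of_annulus {F : Set (Set ℕ)} (hF : IsFurstenbergFamily F)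
    (hr : IsRightInvariant F) (hc : ComplClosedUnderUnion F) {Γ : Set ℂ}
    (hne : (Γ \ {0}).Nonempty) (hbd : Bornology.IsBounded (Γ \ {0}))
    (hbz : IsBoundedAwayFromZero (Γ \ {0})) : IsHypercyclicScalarSet.{u} F Γ := by
  intro Y _ _ _ _ hfin S y
  refine ⟨fun h => ?_, fun h => h.of_one hF hne⟩
  have : Nontrivial Y := by
    by_contra hn
    rw [not_nontrivial_iff_subsingleton] at hn
    exact hfin inferInstance
  obtain ⟨ε, hε, hΓε⟩ := hbz
  obtain ⟨M, hM⟩ := isBounded_iff_forall_norm_le.1 hbd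
  have hM0 : 0 < M := by
    obtain ⟨c, hc⟩ := hne
    exact hε.trans_le ((hΓε c hc).trans (hM c hc))
  have hcov := (h.diff_zero hF).exists_isFamilyLimit hF hc hε fun c hc => ⟨hΓε c hc, hM c hc⟩
  have hR : IsOrbitRelation S (IsFamilyLimit F S) := IsFamilyLimit.isOrbitRelation hF hr
  have hT := denseRange_aeval (denseRange_sub_of_orbit (T := S) (x := y) (inv_pos.2 hM0)
    fun z => by
      obtain ⟨c, h1, h2, h3⟩ := hcov z
      exact ⟨c, h1, h2, h3.mem_closure hF⟩)
  exact isHypercyclicVector_one_iff.2 <| hR.forall_of_circle hT <|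
    hR.exists_circle_of_annulus hT (fun z hz => hz.mem_closure hF) (inv_pos.2 hM0) hcov

/-! ### The backward shift on `ℓ¹` -/

section Shift

/-- The space `ℓ¹(ℕ, ℂ)`. -/
abbrev SummableSeq : Type := lp (fun _ : ℕ => ℂ) 1

namespace SummableSeq

theorem summable_norm (v : SummableSeq) : Summable fun m => ‖v m‖ := by
  simpa using (lp.memℓp v).summable (by simp)

theorem norm_eq_tsum (v : SummableSeq) : ‖v‖ = ∑' m, ‖v m‖ := by
  simpa using lp.norm_eq_tsum_rpow (by simp) v

/-- The element of `ℓ¹` given by an absolutely summable sequence. -/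
def ofSummable (f : ℕ → ℂ) (hf : Summable fun m => ‖f m‖) : SummableSeq :=
  ⟨f, memℓp_gen (by simpa using hf)⟩

/-- The backward shift on `ℓ¹`. -/
noncomputable def shift : SummableSeq →L[ℂ] SummableSeq :=
  LinearMap.mkContinuous
    { toFun := fun v => ofSummable (fun m => v (m + 1)) ((summable_nat_add_iff 1).2 v.summable_norm)
      map_add' := fun v w => by
        apply lp.ext
        rfl
      map_smul' := fun c v => by
        apply lp.ext
        rfl }
    1 (fun v => by
      rw [one_mul, norm_eq_tsum, norm_eq_tsum]
      exact tsum_comp_le_tsum_of_inj v.summable_norm (fun _ => norm_nonneg _)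
        (add_left_injective 1))

theorem shift_apply (v : SummableSeq) (m : ℕ) : shift v m = v (m + 1) := rfl

theorem shift_pow_apply (n : ℕ) (v : SummableSeq) (m : ℕ) : (shift ^ n) v m = v (m + n) := by
  induction n generalizing m with
  | zero => simp
  | succ n ih =>
    have : (shift ^ (n + 1)) v = shift ((shift ^ n) v) := by rw [pow_succ']; rfl
    rw [this, shift_apply, ih, add_right_comm, add_assoc]

theorem norm_shift_le (v : SummableSeq) : ‖shift v‖ ≤ ‖v‖ := by
  rw [norm_eq_tsum, norm_eq_tsum]
  exact tsum_comp_le_tsum_of_inj v.summable_norm (fun _ => norm_nonneg _) (add_left_injective 1)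

theorem norm_shift_pow_le (n : ℕ) (v : SummableSeq) : ‖(shift ^ n) v‖ ≤ ‖v‖ := by
  induction n with
  | zero => simp
  | succ n ih =>
    have : (shift ^ (n + 1)) v = shift ((shift ^ n) v) := by rw [pow_succ']; rfl
    rw [this]
    exact (norm_shift_le _).trans ih

theorem smul_shift_pow (c : ℂ) (n : ℕ) (v : SummableSeq) :
    ((c • shift) ^ n) v = c ^ n • (shift ^ n) v := by
  rw [smul_pow]
  rfl

/-- A vector vanishing on `[0, k)` and dominated beyond by `g` is bounded by a tail of `g`. -/
theorem norm_le_tsum_tail {v : SummableSeq} {g : ℕ → ℝ} (hg : Summable g) (k : ℕ)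
    (h0 : ∀ d < k, v d = 0) (h1 : ∀ d, k ≤ d → ‖v d‖ ≤ g d) : ‖v‖ ≤ ∑' d, g (d + k) := by
  rw [norm_eq_tsum, ← v.summable_norm.sum_add_tsum_nat_add k, Finset.sum_eq_zero, zero_add]
  · exact ((summable_nat_add_iff k).2 v.summable_norm).tsum_le_tsum
      (fun d => h1 _ (Nat.le_add_left _ _)) ((summable_nat_add_iff k).2 hg)
  · intro d hd
    rw [h0 d (Finset.mem_range.1 hd), norm_zero]

theorem dense_finite_support : Dense {v : SummableSeq | ∃ N, ∀ l, N ≤ l → v l = 0} := by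
  intro v
  have h := (lp.hasSum_single (p := 1) (by simp) v).tendsto_sum_nat
  refine mem_closure_of_tendsto h (Filter.Eventually.of_forall fun n => ⟨n, fun l hl => ?_⟩)
  rw [lp.coeFn_sum, Finset.sum_apply]
  refine Finset.sum_eq_zero fun i hi => ?_
  rw [lp.single_apply_ne]
  have := Finset.mem_range.1 hi
  omega

instance : TopologicalSpace.SeparableSpace SummableSeq := by
  have hs : TopologicalSpace.IsSeparable
      (Submodule.span ℂ (Set.range fun i : ℕ => (lp.single 1 i (1 : ℂ) : SummableSeq)) :
        Set SummableSeq) :=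
    (Set.countable_range _).isSeparable.span
  have hd : Dense (Submodule.span ℂ
      (Set.range fun i : ℕ => (lp.single 1 i (1 : ℂ) : SummableSeq)) : Set SummableSeq) := by
    intro v
    have h := (lp.hasSum_single (p := 1) (by simp) v).tendsto_sum_nat
    refine mem_closure_of_tendsto h (Filter.Eventually.of_forall fun n => ?_)
    refine Submodule.sum_mem _ fun i _ => ?_
    have : (lp.single 1 i (v i) : SummableSeq) = v i • lp.single 1 i (1 : ℂ) := by
      rw [← lp.single_smul, smul_eq_mul, mul_one]
    rw [this]
    exact Submodule.smul_mem _ _ (Submodule.subset_span ⟨i, rfl⟩)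
  rw [← TopologicalSpace.isSeparable_univ_iff, ← hd.closure_eq]
  exact hs.closure

theorem not_finiteDimensional : ¬ FiniteDimensional ℂ SummableSeq := by
  intro h
  have hli : LinearIndependent ℂ (fun i : ℕ => (lp.single 1 i (1 : ℂ) : SummableSeq)) := by
    rw [linearIndependent_iff']
    intro s g hg i hi
    have := congrArg (fun v : SummableSeq => v i) hg
    simp only [lp.coeFn_sum, Finset.sum_apply, lp.coeFn_smul, Pi.smul_apply, lp.coeFn_zero,
      Pi.zero_apply] at this
    rw [Finset.sum_eq_single i] at this
    · simpa using this
    · intro j _ hj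
      rw [lp.single_apply_ne _ _ _ hj.symm, smul_zero]
    · exact fun h => absurd hi h
  have := hli.finite
  exact not_finite ℕ

theorem exists_dense_sequence :
    ∃ z : ℕ → SummableSeq, DenseRange z ∧ ∀ i, ∃ N, ∀ l, N ≤ l → z i l = 0 := by
  obtain ⟨t, hts, htc, htd⟩ := dense_finite_support.exists_countable_dense_subset
  obtain ⟨z, hz⟩ := htc.exists_eq_range htd.nonempty
  refine ⟨z, by rw [DenseRange, ← hz]; exact htd, fun i => ?_⟩
  have : z i ∈ t := hz ▸ ⟨i, rfl⟩
  exact hts this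

end SummableSeq

end Shift

/-- A hypercyclic scalar set in universe `u` has the defining property on spaces in `Type`. -/
theorem IsHypercyclicScalarSet.iff_of_type_zero {F : Set (Set ℕ)} {Γ : Set ℂ}
    (h : IsHypercyclicScalarSet.{u} F Γ) {X : Type} [NormedAddCommGroup X] [NormedSpace ℂ X]
    [CompleteSpace X] [TopologicalSpace.SeparableSpace X] (hX : ¬ FiniteDimensional ℂ X)
    (T : X →L[ℂ] X) (x : X) :
    IsHypercyclicVector F Γ T x ↔ IsHypercyclicVector F {1} T x := by
  let e : ULift.{u} X ≃L[ℂ] X := ContinuousLinearEquiv.ulift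
  have hsep : TopologicalSpace.SeparableSpace (ULift.{u} X) :=
    e.symm.surjective.denseRange.separableSpace e.symm.continuous
  have hfin : ¬ FiniteDimensional ℂ (ULift.{u} X) := fun hf =>
    hX (e.toLinearEquiv.finiteDimensional)
  let S : ULift.{u} X →L[ℂ] ULift.{u} X := (e.symm : X →L[ℂ] ULift.{u} X) ∘L T ∘L
    (e : ULift.{u} X →L[ℂ] X)
  have hS : ∀ (n : ℕ) (v : X), (S ^ n) (e.symm v) = e.symm ((T ^ n) v) := by
    intro n v
    induction n with
    | zero => simp
    | succ n ih =>
      have h1 : (S ^ (n + 1)) (e.symm v) = S ((S ^ n) (e.symm v)) := by rw [pow_succ']; rfl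
      have h2 : (T ^ (n + 1)) v = T ((T ^ n) v) := by rw [pow_succ']; rfl
      rw [h1, h2, ih]
      change e.symm (T (e (e.symm ((T ^ n) v)))) = _
      rw [ContinuousLinearEquiv.apply_symm_apply]
  have hret : ∀ (Δ : Set ℂ) (U : Set X),
      returnSet T Δ x U = returnSet S Δ (e.symm x) (e ⁻¹' U) := by
    intro Δ U
    ext n
    simp only [returnSet, Set.mem_ofPred_eq, Set.Nonempty, Set.mem_inter_iff, Set.mem_image,
      exists_exists_and_eq_and, Set.mem_preimage]
    refine exists_congr fun c => and_congr_right fun _ => ?_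
    rw [← map_smul, hS, ContinuousLinearEquiv.apply_symm_apply]
  have hvec : ∀ Δ : Set ℂ, IsHypercyclicVector F Δ T x ↔ IsHypercyclicVector F Δ S (e.symm x) := by
    intro Δ
    constructor
    · intro hv U hU hne
      have := hv (e.symm ⁻¹' U) (hU.preimage e.symm.continuous)
        (hne.preimage e.symm.surjective)
      rw [hret, ← Set.preimage_comp] at this
      simpa using this
    · intro hv U hU hne
      rw [hret]
      exact hv _ (hU.preimage e.continuous) (hne.preimage e.surjective)
  rw [hvec, hvec]
  exact h (ULift.{u} X) hfin S (e.symm x)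

/-! ### Vectors with prescribed scaled returns -/

section Construction

/-- Non-empty sets `A 1, A 2, …` of times, pairwise disjoint and separated as in a hypercyclicity
set. -/
structure IsSeparatedSeq (A : ℕ → Set ℕ) : Prop where
  nonempty : ∀ k, 1 ≤ k → (A k).Nonempty
  index_unique : ∀ {k k' n}, 1 ≤ k → 1 ≤ k' → n ∈ A k → n ∈ A k' → k = k'
  add_le : ∀ {k k' n n'}, 1 ≤ k → 1 ≤ k' → n ∈ A k → n' ∈ A k' → n < n' →
    n + k ≤ n' ∧ n + k' ≤ n'

theorem IsHypercyclicitySet.exists_isSeparatedSeq {F : Set (Set ℕ)} (hF : IsHypercyclicitySet F) :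
    ∃ A : ℕ → Set ℕ, (∀ k, 1 ≤ k → A k ∈ F) ∧ IsSeparatedSeq A := by
  obtain ⟨A, hA, hdisj, hsep⟩ := hF.exists_separated
  refine ⟨A, hA, ⟨fun k hk => ?_, fun {k k' n} hk hk' hn hn' => ?_,
    fun {k k' n n'} hk hk' hn hn' hlt => ?_⟩⟩
  · rw [Set.nonempty_iff_ne_empty]
    intro he
    exact hF.furstenberg.empty_notMem (he ▸ hA k hk)
  · by_contra hne
    exact Set.disjoint_left.1 (hdisj k k' hk hk' hne) hn hn'
  · have := hsep k k' hk hk' n hn n' hn' hlt.ne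
    rw [abs_sub_comm, abs_of_nonneg (by omega)] at this
    omega

namespace IsSeparatedSeq

variable {A : ℕ → Set ℕ}

/-- The elements of `A k` are large when `k` is. -/
theorem exists_forall_ge (hA : IsSeparatedSeq A) (M : ℕ) :
    ∃ K, ∀ k, K ≤ k → ∀ n ∈ A k, M ≤ n := by
  -- Compare with a fixed `e ∈ A 1`: for large `k` an element of `A k` cannot precede `e`, as the
  -- gap would exceed `e`, so it comes at least `k` after `e`.
  obtain ⟨e, he⟩ := hA.nonempty 1 le_rfl
  refine ⟨e + M + 2, fun k hk n hn => ?_⟩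
  rcases lt_trichotomy n e with h | rfl | h
  · have := (hA.add_le (by omega) le_rfl hn he h).1
    omega
  · have := hA.index_unique (by omega) le_rfl hn he
    omega
  · have := (hA.add_le le_rfl (by omega) he hn h).2
    omega

/-- The intervals `[n, n + k)` with `n ∈ A k` are pairwise disjoint. -/
theorem block_unique (hA : IsSeparatedSeq A) {k k' n n' m : ℕ} (hk : 1 ≤ k) (hk' : 1 ≤ k')
    (hn : n ∈ A k) (hn' : n' ∈ A k') (h1 : n ≤ m) (h2 : m < n + k) (h1' : n' ≤ m)
    (h2' : m < n' + k') : n = n' ∧ k = k' := by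
  rcases lt_trichotomy n n' with h | rfl | h
  · have := (hA.add_le hk hk' hn hn' h).1
    omega
  · exact ⟨rfl, hA.index_unique hk hk' hn hn'⟩
  · have := (hA.add_le hk' hk hn' hn h).1
    omega

end IsSeparatedSeq

/-- The pair `(k, n)` indexes the block `[n, n + k)` around `m`. -/
def IsBlockAt (A : ℕ → Set ℕ) (m : ℕ) (q : ℕ × ℕ) : Prop :=
  1 ≤ q.1 ∧ q.2 ∈ A q.1 ∧ q.2 ≤ m ∧ m < q.2 + q.1

open Classical in
/-- The sequence whose restriction to the block `[n, n + k)`, `n ∈ A k`, is `(β n)⁻¹ y k`. -/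
noncomputable def blockSeq (A : ℕ → Set ℕ) (β : ℕ → ℂ) (y : ℕ → ℕ → ℂ) (m : ℕ) : ℂ :=
  if h : ∃ q, IsBlockAt A m q then (β h.choose.2)⁻¹ * y h.choose.1 (m - h.choose.2) else 0

variable {A : ℕ → Set ℕ} {β : ℕ → ℂ} {y : ℕ → ℕ → ℂ}

theorem blockSeq_of_block (hA : IsSeparatedSeq A) {k n m : ℕ} (h : IsBlockAt A m (k, n)) :
    blockSeq A β y m = (β n)⁻¹ * y k (m - n) := by
  have hex : ∃ q, IsBlockAt A m q := ⟨_, h⟩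
  have hs := hex.choose_spec
  obtain ⟨h1, h2⟩ := hA.block_unique hs.1 h.1 hs.2.1 h.2.1 hs.2.2.1 hs.2.2.2 h.2.2.1 h.2.2.2
  rw [blockSeq, dif_pos hex, h1, h2]

theorem blockSeq_eq_zero {m : ℕ} (h : ¬ ∃ q, IsBlockAt A m q) : blockSeq A β y m = 0 := by
  rw [blockSeq, dif_neg h]

/-- If `m` lies in a later block `[n', n' + k')`, separation gives `k' ≤ n' - n`, so `m - n < 2 (n'
- n)`. Growth 4 per unit of time in `β` thus becomes decay 1/2 per unit of `m - n`, while the block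
entry is at most `k' ≤ m - n`. -/
theorem norm_mul_blockSeq_le (hA : IsSeparatedSeq A) (hβ0 : ∀ n, β n ≠ 0)
    (hβ : ∀ k k' n n', 1 ≤ k → 1 ≤ k' → n ∈ A k → n' ∈ A k' → n < n' →
      4 ^ (n' - n) * ‖β n‖ ≤ ‖β n'‖)
    (hy : ∀ k l, ‖y k l‖ ≤ k) {k n m : ℕ} (hk : 1 ≤ k) (hn : n ∈ A k) (hm : n + k ≤ m) :
    ‖β n * blockSeq A β y m‖ ≤ ((m - n : ℕ) : ℝ) * (1 / 2) ^ (m - n) := by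
  by_cases hex : ∃ q, IsBlockAt A m q
  · obtain ⟨⟨k', n'⟩, hq⟩ := hex
    have hval := blockSeq_of_block (β := β) (y := y) hA hq
    obtain ⟨hk', hn', h1, h2⟩ := hq
    simp only at hk' hn' h1 h2
    have hlt : n < n' := by
      rcases lt_trichotomy n n' with h | rfl | h
      · exact h
      · have := hA.index_unique hk hk' hn hn'
        omega
      · have := (hA.add_le hk' hk hn' hn h).1
        omega
    have hsep := (hA.add_le hk hk' hn hn' hlt).2
    have hb := hβ k k' n n' hk hk' hn hn' hlt
    have hpos : 0 < ‖β n'‖ := norm_pos_iff.2 (hβ0 n')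
    have hratio : ‖β n‖ * ‖β n'‖⁻¹ ≤ (1 / 2) ^ (m - n) := by
      rw [← div_eq_mul_inv, div_le_iff₀ hpos]
      calc ‖β n‖ = (1 / 4) ^ (n' - n) * (4 ^ (n' - n) * ‖β n‖) := by
            rw [← mul_assoc, ← mul_pow]
            norm_num
        _ ≤ (1 / 4) ^ (n' - n) * ‖β n'‖ := by gcongr
        _ = (1 / 2) ^ (2 * (n' - n)) * ‖β n'‖ := by
            rw [pow_mul]
            norm_num
        _ ≤ (1 / 2) ^ (m - n) * ‖β n'‖ := by
            gcongr ?_ * _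
            exact pow_le_pow_of_le_one (by norm_num) (by norm_num) (by omega)
    have hyk : ‖y k' (m - n')‖ ≤ ((m - n : ℕ) : ℝ) := by
      refine (hy _ _).trans ?_
      exact_mod_cast (by omega : k' ≤ m - n)
    rw [hval, norm_mul, norm_mul, norm_inv, ← mul_assoc, mul_comm (((m - n : ℕ) : ℝ))]
    gcongr
  · rw [blockSeq_eq_zero hex, mul_zero, norm_zero]
    positivity

theorem summable_mul_half_pow : Summable fun d : ℕ => (d : ℝ) * (1 / 2) ^ d := by
  have := summable_pow_mul_geometric_of_norm_lt_one 1 (r := (1 / 2 : ℝ)) (by norm_num)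
  simpa using this

theorem summable_norm_blockSeq (hA : IsSeparatedSeq A) (hβ0 : ∀ n, β n ≠ 0)
    (hβ : ∀ k k' n n', 1 ≤ k → 1 ≤ k' → n ∈ A k → n' ∈ A k' → n < n' →
      4 ^ (n' - n) * ‖β n‖ ≤ ‖β n'‖)
    (hy : ∀ k l, ‖y k l‖ ≤ k) : Summable fun m => ‖blockSeq A β y m‖ := by
  obtain ⟨n, hn⟩ := hA.nonempty 1 le_rfl
  rw [← summable_nat_add_iff (n + 1)]
  have hs := ((summable_nat_add_iff 1).2 summable_mul_half_pow).mul_left ‖β n‖⁻¹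
  refine hs.of_nonneg_of_le (fun _ => norm_nonneg _) fun d => ?_
  have := norm_mul_blockSeq_le hA hβ0 hβ hy le_rfl hn (m := d + (n + 1)) (by omega)
  rw [norm_mul, show d + (n + 1) - n = d + 1 by omega] at this
  rw [← div_eq_inv_mul, le_div_iff₀' (norm_pos_iff.2 (hβ0 n))]
  exact this

/-- There is a vector of `ℓ¹` whose shifts, rescaled by a fast growing sequence `β`, visit each
open set along infinitely many of the sets `A k`; its non-zero coordinates can be kept above
prescribed small thresholds. -/
theorem exists_scaled_returns (hA : IsSeparatedSeq A) (hβ0 : ∀ n, β n ≠ 0)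
    (hβ : ∀ k k' n n', 1 ≤ k → 1 ≤ k' → n ∈ A k → n' ∈ A k' → n < n' →
      4 ^ (n' - n) * ‖β n‖ ≤ ‖β n'‖)
    {ρ : ℕ → ℝ} (hρ : Filter.Tendsto ρ Filter.atTop (nhds 0)) :
    ∃ x : SummableSeq,
      (∀ U : Set SummableSeq, IsOpen U → U.Nonempty → ∀ K, ∃ k, K ≤ k ∧ 1 ≤ k ∧
        ∀ n ∈ A k, β n • (SummableSeq.shift ^ n) x ∈ U) ∧
      ∀ m, x m = 0 ∨ ∃ n, n ≤ m ∧ ρ n ≤ ‖β n * x m‖ := by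
  classical
  obtain ⟨z, hzd, hzs⟩ := SummableSeq.exists_dense_sequence
  -- Each `z i` is good for all large `k`: it has finite support, and the times in `A k` become
  -- large, so `ρ` falls below its smallest non-zero entry there.
  let good : ℕ → ℕ → Prop := fun i k =>
    (∀ l, k ≤ l → z i l = 0) ∧ (∀ l, ‖z i l‖ ≤ k) ∧ ∀ n ∈ A k, ∀ l, z i l ≠ 0 → ρ n ≤ ‖z i l‖
  have hgood : ∀ i, ∃ K, ∀ k, K ≤ k → good i k := by
    intro i
    obtain ⟨N, hN⟩ := hzs i
    obtain ⟨K₁, hK₁⟩ := exists_nat_ge ‖z i‖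
    obtain ⟨δ, hδ, hδz⟩ : ∃ δ > 0, ∀ l, z i l ≠ 0 → δ ≤ ‖z i l‖ := by
      have hfin : {l | z i l ≠ 0}.Finite :=
        (Set.finite_lt_nat N).subset fun l hl => not_le.1 fun h => hl (hN l h)
      rcases Set.eq_empty_or_nonempty {l | z i l ≠ 0} with he | hne
      · refine ⟨1, one_pos, fun l hl => ?_⟩
        have : l ∈ {l | z i l ≠ 0} := hl
        simp [he] at this
      · obtain ⟨l₀, hl₀, hmin⟩ := Set.exists_min_image _ (fun l => ‖z i l‖) hfin hne
        exact ⟨‖z i l₀‖, norm_pos_iff.2 hl₀, fun l hl => hmin l hl⟩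
    obtain ⟨M, hM⟩ := Filter.eventually_atTop.1 (hρ.eventually_le_const hδ)
    obtain ⟨K₂, hK₂⟩ := hA.exists_forall_ge M
    refine ⟨max N (max K₁ K₂), fun k hk => ⟨fun l hl => hN l (by omega), fun l => ?_,
      fun n hn l hl => (hM n (hK₂ k (by omega) n hn)).trans (hδz l hl)⟩⟩
    refine (lp.norm_apply_le_norm one_ne_zero (z i) l).trans (hK₁.trans ?_)
    exact_mod_cast (by omega : K₁ ≤ k)
  -- Unpairing `k` assigns each `z i` to infinitely many blocks.
  let y : ℕ → SummableSeq := fun k => if good k.unpair.1 k then z k.unpair.1 else 0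
  have hy0 : ∀ k l, k ≤ l → y k l = 0 := by
    intro k l hl
    by_cases h : good k.unpair.1 k
    · simpa only [y, if_pos h] using h.1 l hl
    · simp only [y, if_neg h]
      rfl
  have hyk : ∀ k l, ‖y k l‖ ≤ k := by
    intro k l
    by_cases h : good k.unpair.1 k
    · simpa only [y, if_pos h] using h.2.1 l
    · simp [y, if_neg h]
  have hyρ : ∀ k, ∀ n ∈ A k, ∀ l, y k l ≠ 0 → ρ n ≤ ‖y k l‖ := by
    intro k n hn l hl
    by_cases h : good k.unpair.1 k
    · simp only [y, if_pos h] at hl ⊢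
      exact h.2.2 n hn l hl
    · simp [y, if_neg h] at hl
  let x : SummableSeq := SummableSeq.ofSummable (blockSeq A β fun k l => y k l)
    (summable_norm_blockSeq hA hβ0 hβ hyk)
  have hx : ∀ m, x m = blockSeq A β (fun k l => y k l) m := fun _ => rfl
  refine ⟨x, fun U hU hne K => ?_, fun m => ?_⟩
  · obtain ⟨i, hi⟩ := hzd.exists_mem_open hU hne
    obtain ⟨ε, hε, hball⟩ := Metric.isOpen_iff.1 hU _ hi
    obtain ⟨K₁, hK₁⟩ := hgood i
    have htail := tendsto_sum_nat_add fun d : ℕ => (d : ℝ) * (1 / 2) ^ d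
    obtain ⟨K₂, hK₂⟩ := Filter.eventually_atTop.1 (htail.eventually_lt_const hε)
    set k := Nat.pair i (max K (max K₁ (max K₂ 1))) with hk
    have hkge : max K (max K₁ (max K₂ 1)) ≤ k := Nat.right_le_pair _ _
    have hyi : y k = z i := by
      have : k.unpair.1 = i := by simp [hk]
      simp only [y, this]
      exact if_pos (hK₁ k (by omega))
    have hk1 : 1 ≤ k := by omega
    -- For `n ∈ A k`, the rescaled shift agrees with `z i` on `[0, k)`, and beyond is bounded by a
    -- tail of `∑ d / 2 ^ d`.
    refine ⟨k, by omega, hk1, fun n hn => hball ?_⟩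
    rw [Metric.mem_ball, dist_eq_norm, ← hyi]
    refine (SummableSeq.norm_le_tsum_tail summable_mul_half_pow k (fun d hd => ?_)
      (fun d hd => ?_)).trans_lt (hK₂ k (by omega))
    · rw [lp.coeFn_sub, Pi.sub_apply, lp.coeFn_smul, Pi.smul_apply, SummableSeq.shift_pow_apply,
        hx, blockSeq_of_block hA (k := k) (n := n) ⟨hk1, hn, by simp, by simp only; omega⟩,
        smul_eq_mul, mul_inv_cancel_left₀ (hβ0 n), Nat.add_sub_cancel, sub_self]
    · rw [lp.coeFn_sub, Pi.sub_apply, lp.coeFn_smul, Pi.smul_apply, SummableSeq.shift_pow_apply,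
        hy0 k d hd, sub_zero, smul_eq_mul, hx]
      have := norm_mul_blockSeq_le hA hβ0 hβ hyk hk1 hn (m := d + n) (by omega)
      rwa [Nat.add_sub_cancel] at this
  · by_cases hex : ∃ q, IsBlockAt A m q
    · obtain ⟨⟨k, n⟩, hq⟩ := hex
      have hval := blockSeq_of_block (β := β) (y := fun k l => y k l) hA hq
      by_cases hy' : y k (m - n) = 0
      · left
        rw [hx, hval]
        simp only [hy', mul_zero]
      · right
        refine ⟨n, hq.2.2.1, ?_⟩
        rw [hx, hval, mul_inv_cancel_left₀ (hβ0 n)]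
        exact hyρ k n hq.2.1 _ hy'
    · left
      rw [hx, blockSeq_eq_zero hex]

end Construction

/-! ### Necessary conditions on hypercyclic scalar sets -/

section Necessary

open SummableSeq

theorem mem_returnSet_smul_shift {Γ : Set ℂ} {γ c : ℂ} (hγ : γ ∈ Γ) {n : ℕ} {x : SummableSeq}
    {U : Set SummableSeq} (h : (γ * c ^ n) • (shift ^ n) x ∈ U) :
    n ∈ returnSet (c • shift) Γ x U := by
  refine ⟨_, ⟨_, ⟨γ, hγ, rfl⟩, rfl⟩, ?_⟩
  rwa [smul_shift_pow, map_smul, smul_smul, mul_comm]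

/-- A multiple of the shift has a hypercyclic vector along every hypercyclicity set. -/
theorem IsHypercyclicitySet.exists_isHypercyclicVector {F : Set (Set ℕ)}
    (hF : IsHypercyclicitySet F) :
    ∃ x : SummableSeq, IsHypercyclicVector F {1} ((4 : ℂ) • shift) x := by
  obtain ⟨A, hAF, hA⟩ := hF.exists_isSeparatedSeq
  obtain ⟨x, hx, -⟩ := exists_scaled_returns hA (β := fun n => (4 : ℂ) ^ n) (ρ := fun _ => 0)
    (fun n => by simp) (fun k k' n n' _ _ _ _ hlt => by
      rw [norm_pow, norm_pow, Complex.norm_ofNat, ← pow_add, Nat.sub_add_cancel hlt.le])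
    tendsto_const_nhds
  refine ⟨x, fun U hU hne => ?_⟩
  obtain ⟨k, -, hk, hkU⟩ := hx U hU hne 0
  refine hF.furstenberg.upward _ _ (fun n hn => ?_) (hAF k hk)
  refine mem_returnSet_smul_shift (γ := 1) (Set.mem_singleton 1) ?_
  rw [one_mul]
  exact hkU n hn

/-- If `Γ ⊆ {0}`, no vector is hypercyclic up to `Γ`, whereas `4 • shift` has a hypercyclic vector.
-/
theorem IsHypercyclicScalarSet.nonempty {F : Set (Set ℕ)} (hF : IsHypercyclicitySet F) {Γ : Set ℂ}
    (hΓ : IsHypercyclicScalarSet.{u} F Γ) : (Γ \ {0}).Nonempty := by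
  by_contra hemp
  rw [Set.not_nonempty_iff_eq_empty] at hemp
  obtain ⟨x, hx⟩ := hF.exists_isHypercyclicVector
  have hx' := (hΓ.iff_of_type_zero not_finiteDimensional _ x).2 hx
  have hne : ({0}ᶜ : Set SummableSeq).Nonempty := by
    refine ⟨lp.single 1 0 1, fun h => ?_⟩
    have := congrArg (fun v : SummableSeq => v 0) (Set.mem_singleton_iff.1 h)
    simp at this
  refine hF.furstenberg.empty_notMem ?_
  convert hx' _ isOpen_compl_singleton hne
  refine (Set.eq_empty_iff_forall_notMem.2 ?_).symm
  rintro n ⟨_, ⟨_, ⟨c, hc, rfl⟩, rfl⟩, h0⟩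
  have hc0 : c = 0 := by
    by_contra hc0
    have : c ∈ Γ \ {0} := ⟨hc, hc0⟩
    rw [hemp] at this
    exact this
  refine h0 ?_
  simp only [hc0, zero_smul, map_zero, Set.mem_singleton_iff]

theorem exists_seq_of_not_isBounded {S : Set ℂ} (hS : ¬ Bornology.IsBounded S) :
    ∃ γ : ℕ → ℂ, (∀ n, γ n ∈ S) ∧ (∀ n, γ n ≠ 0) ∧
      ∀ n n', n ≤ n' → 4 ^ (n' - n) * ‖γ n‖ ≤ ‖γ n'‖ := by
  have hex : ∀ r : ℝ, ∃ c ∈ S, r < ‖c‖ := by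
    intro r
    by_contra! hr
    exact hS (isBounded_iff_forall_norm_le.2 ⟨r, hr⟩)
  choose f hfS hf using hex
  let γ : ℕ → ℂ := fun n => Nat.rec (f 1) (fun _ c => f (4 * ‖c‖)) n
  have hstep : ∀ n, 4 * ‖γ n‖ ≤ ‖γ (n + 1)‖ := fun n => (hf _).le
  refine ⟨γ, fun n => ?_, fun n => ?_, fun n n' h => ?_⟩
  · cases n <;> exact hfS _
  · rw [← norm_pos_iff]
    rcases n with _ | n
    · exact zero_lt_one.trans (hf 1)
    · exact lt_of_le_of_lt (by positivity) (hf (4 * ‖γ n‖))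
  · induction n', h using Nat.le_induction with
    | base => simp
    | succ m hm ih =>
      rw [Nat.succ_sub hm, pow_succ]
      linarith [hstep m]

/-- Scalars `γ n ∈ Γ` growing by a factor 4 make some vector hypercyclic up to `Γ` for the shift, a
contraction whose orbits are bounded. -/
theorem IsHypercyclicScalarSet.isBounded {F : Set (Set ℕ)} (hF : IsHypercyclicitySet F) {Γ : Set ℂ}
    (hΓ : IsHypercyclicScalarSet.{u} F Γ) : Bornology.IsBounded (Γ \ {0}) := by
  by_contra hbd
  obtain ⟨γ, hγΓ, hγ0, hγ⟩ := exists_seq_of_not_isBounded hbd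
  obtain ⟨A, hAF, hA⟩ := hF.exists_isSeparatedSeq
  obtain ⟨x, hx, -⟩ := exists_scaled_returns hA (β := γ) (ρ := fun _ => 0) hγ0
    (fun k k' n n' _ _ _ _ hlt => hγ n n' hlt.le) tendsto_const_nhds
  have hxΓ : IsHypercyclicVector F Γ ((1 : ℂ) • shift) x := by
    intro U hU hne
    obtain ⟨k, -, hk, hkU⟩ := hx U hU hne 0
    refine hF.furstenberg.upward _ _ (fun n hn => ?_) (hAF k hk)
    refine mem_returnSet_smul_shift (hγΓ n).1 ?_
    rw [one_pow, mul_one]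
    exact hkU n hn
  have hx1 := (hΓ.iff_of_type_zero not_finiteDimensional _ x).1 hxΓ
  have hne : {v : SummableSeq | ‖x‖ < ‖v‖}.Nonempty := by
    refine ⟨lp.single 1 0 ((‖x‖ + 1 : ℝ) : ℂ), ?_⟩
    rw [Set.mem_ofPred_eq, lp.norm_single one_pos, Complex.norm_real,
      Real.norm_of_nonneg (by positivity)]
    linarith
  have := hx1 _ (isOpen_lt continuous_const continuous_norm) hne
  rw [returnSet_singleton_one] at this
  refine hF.furstenberg.empty_notMem ?_
  convert this
  refine (Set.eq_empty_iff_forall_notMem.2 fun n hn => ?_).symm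
  rw [Set.mem_ofPred_eq, Set.mem_ofPred_eq, one_smul] at hn
  exact absurd (norm_shift_pow_le n x) (not_le.2 hn)

/-- A null sequence can be slowed down so that its jumps are dominated by the gaps of a separated
sequence of sets of times. -/
theorem IsSeparatedSeq.exists_slow_index {A : ℕ → Set ℕ} (hA : IsSeparatedSeq A) {α : ℕ → ℂ}
    (hα0 : ∀ n, α n ≠ 0) (hα : Antitone fun n => ‖α n‖) :
    ∃ ι : ℕ → ℕ, Filter.Tendsto ι Filter.atTop Filter.atTop ∧
      ∀ k k' n n', 1 ≤ k → 1 ≤ k' → n ∈ A k → n' ∈ A k' → n < n' →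
        ‖α (ι n)‖ ≤ 4 ^ (n' - n) * ‖α (ι n')‖ := by
  have hL : ∀ i, ∃ L : ℕ, ‖α 0‖ ≤ 4 ^ L * ‖α i‖ := by
    intro i
    obtain ⟨L, hL⟩ := pow_unbounded_of_one_lt (‖α 0‖ / ‖α i‖) (by norm_num : (1 : ℝ) < 4)
    exact ⟨L, ((div_lt_iff₀ (norm_pos_iff.2 (hα0 i))).1 hL).le⟩
  choose L hL using hL
  choose K hK using hA.exists_forall_ge
  -- The time `p i` is at least `i`, and any earlier time of the separated sets precedes it by at
  -- least `L i`. The index `ι` reaches `i` only from time `p i` on, so that gap pays for the drop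
  -- of ‖α‖.
  choose p hp using fun i : ℕ => hA.nonempty (max 1 (max (K i) (L i))) (le_max_left _ _)
  have hpi : ∀ i, i ≤ p i := fun i => hK i _ (by omega) _ (hp i)
  let ι : ℕ → ℕ := fun n => Nat.findGreatest (fun i => p i ≤ n) n
  have hle : ∀ i n, p i ≤ n → i ≤ ι n := fun i n h =>
    Nat.le_findGreatest ((hpi i).trans h) h
  have hspec : ∀ n, ι n ≠ 0 → p (ι n) ≤ n := fun n h =>
    Nat.findGreatest_of_ne_zero (P := fun i => p i ≤ n) rfl h
  have hmono : Monotone ι := by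
    intro n n' hnn'
    by_cases h : ι n = 0
    · rw [h]
      exact Nat.zero_le _
    · exact hle _ _ ((hspec n h).trans hnn')
  refine ⟨ι, Filter.tendsto_atTop.2 fun i => Filter.eventually_atTop.2
    ⟨p i, fun n hn => hle i n hn⟩, fun k k' n n' hk hk' hn hn' hlt => ?_⟩
  rcases (hmono hlt.le).eq_or_lt with heq | hlt'
  · rw [heq]
    exact le_mul_of_one_le_left (norm_nonneg _) (one_le_pow₀ (by norm_num))
  · have h1 : p (ι n') ≤ n' := hspec n' (by omega)
    have h2 : n < p (ι n') := by
      by_contra! h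
      have := hle _ _ h
      omega
    have h3 := (hA.add_le hk (by omega) hn (hp (ι n')) h2).2
    calc ‖α (ι n)‖ ≤ ‖α 0‖ := hα (Nat.zero_le _)
      _ ≤ 4 ^ L (ι n') * ‖α (ι n')‖ := hL _
      _ ≤ 4 ^ (n' - n) * ‖α (ι n')‖ := by
          gcongr
          · norm_num
          · omega

theorem summable_inv_sixteen_pow : Summable fun m : ℕ => ‖((16 : ℂ) ^ m)⁻¹‖ := by
  have := summable_geometric_of_lt_one (r := (1 / 16 : ℝ)) (by norm_num) (by norm_num)
  simpa using this

/-- The non-zero elements of a hypercyclic scalar set do not accumulate at `0`: along a null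
sequence of scalars one finds a vector whose orbit under `16 • shift` keeps its first coordinate
outside the unit disc, but which is hypercyclic up to these scalars. -/
theorem IsHypercyclicScalarSet.decreasingNullSeqs_eq_empty {F : Set (Set ℕ)}
    (hF : IsHypercyclicitySet F) {Γ : Set ℂ} (hΓ : IsHypercyclicScalarSet.{u} F Γ) :
    decreasingNullSeqs Γ = ∅ := by
  rw [Set.eq_empty_iff_forall_notMem]
  rintro α ⟨hαΓ, hαanti, hαlim⟩
  have hα0 : ∀ n, α n ≠ 0 := fun n => (hαΓ n).2
  obtain ⟨A, hAF, hA⟩ := hF.exists_isSeparatedSeq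
  obtain ⟨ι, hι, hια⟩ := hA.exists_slow_index hα0 hαanti
  have hlim : Filter.Tendsto (fun n => ‖α (ι n)‖) Filter.atTop (nhds 0) := hαlim.comp hι
  -- Of 16 = 4 · 4, one factor compensates the decrease of ‖α‖ and the other gives the growth
  -- required of `β`. The threshold `ρ` makes every non-zero entry satisfy ‖16 ^ n * x m‖ ≥ 2 for
  -- some `n ≤ m`, hence also ‖16 ^ m * x m‖ ≥ 2.
  obtain ⟨x, hx, hxρ⟩ := exists_scaled_returns hA (β := fun n => α (ι n) * 16 ^ n)
    (ρ := fun n => 2 * ‖α (ι n)‖) (fun n => mul_ne_zero (hα0 _) (by simp))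
    (fun k k' n n' hk hk' hn hn' hlt => by
      have h1 := hια k k' n n' hk hk' hn hn' hlt
      rw [norm_mul, norm_mul, norm_pow, norm_pow, Complex.norm_ofNat]
      calc (4 : ℝ) ^ (n' - n) * (‖α (ι n)‖ * 16 ^ n)
          ≤ 4 ^ (n' - n) * ((4 ^ (n' - n) * ‖α (ι n')‖) * 16 ^ n) := by gcongr
        _ = ‖α (ι n')‖ * (16 ^ (n' - n) * 16 ^ n) := by
            have : (16 : ℝ) ^ (n' - n) = 4 ^ (n' - n) * 4 ^ (n' - n) := by
              rw [← mul_pow]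
              norm_num
            rw [this]
            ring
        _ = ‖α (ι n')‖ * 16 ^ n' := by rw [← pow_add, Nat.sub_add_cancel hlt.le])
    (by simpa using hlim.const_mul 2)
  -- `f` is fixed by `16 • shift`. Scaled by `α (ι n)` it tends to 0, but unscaled it adds 1 to the
  -- coordinate 0 of each orbit point, which is then `1` or of modulus at least 2 - 1.
  let f : SummableSeq := ofSummable (fun m => ((16 : ℂ) ^ m)⁻¹) summable_inv_sixteen_pow
  have hf : ∀ n : ℕ, (16 : ℂ) ^ n • (shift ^ n) f = f := by
    intro n
    apply lp.ext
    funext m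
    rw [lp.coeFn_smul, Pi.smul_apply, shift_pow_apply]
    change (16 : ℂ) ^ n * ((16 : ℂ) ^ (m + n))⁻¹ = ((16 : ℂ) ^ m)⁻¹
    rw [pow_add]
    field_simp
  have hxΓ : IsHypercyclicVector F Γ ((16 : ℂ) • shift) (x + f) := by
    intro U hU hne
    obtain ⟨w, hw⟩ := hne
    obtain ⟨ε, hε, hball⟩ := Metric.isOpen_iff.1 hU w hw
    have hsmall : Filter.Tendsto (fun n => ‖α (ι n)‖ * ‖f‖) Filter.atTop (nhds 0) := by
      simpa using hlim.mul_const ‖f‖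
    obtain ⟨M, hM⟩ := Filter.eventually_atTop.1 (hsmall.eventually_lt_const (half_pos hε))
    obtain ⟨K, hK⟩ := hA.exists_forall_ge M
    obtain ⟨k, hKk, hk, hkU⟩ := hx (Metric.ball w (ε / 2)) Metric.isOpen_ball
      ⟨w, Metric.mem_ball_self (half_pos hε)⟩ K
    refine hF.furstenberg.upward _ _ (fun n hn => ?_) (hAF k hk)
    refine mem_returnSet_smul_shift (hαΓ (ι n)).1 (hball ?_)
    have h1 := hkU n hn
    rw [Metric.mem_ball, dist_eq_norm] at h1 ⊢
    have h2 : (α (ι n) * 16 ^ n) • (shift ^ n) (x + f) - w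
        = ((α (ι n) * 16 ^ n) • (shift ^ n) x - w) + α (ι n) • f := by
      rw [map_add, smul_add, mul_smul _ _ ((shift ^ n) f), hf]
      abel
    rw [h2]
    have h3 := hM n (hK k hKk n hn)
    calc _ ≤ ‖(α (ι n) * 16 ^ n) • (shift ^ n) x - w‖ + ‖α (ι n) • f‖ := norm_add_le _ _
      _ < ε / 2 + ε / 2 := by
          rw [norm_smul (α (ι n)) f]
          exact add_lt_add h1 h3
      _ = ε := add_halves ε
  have hx1 := (hΓ.iff_of_type_zero not_finiteDimensional _ _).1 hxΓ
  have hopen : IsOpen {v : SummableSeq | ‖v 0‖ < 1} :=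
    isOpen_lt (lp.evalCLM ℂ (fun _ : ℕ => ℂ) 1 0).continuous.norm continuous_const
  have hret := hx1 _ hopen ⟨0, by simp⟩
  rw [returnSet_singleton_one] at hret
  refine hF.furstenberg.empty_notMem ?_
  convert hret
  refine (Set.eq_empty_iff_forall_notMem.2 fun m hm => ?_).symm
  have hcoord : ((((16 : ℂ) • shift) ^ m) (x + f)) 0 = 16 ^ m * x m + 1 := by
    rw [smul_shift_pow, map_add, smul_add, hf, lp.coeFn_add, Pi.add_apply, lp.coeFn_smul,
      Pi.smul_apply, shift_pow_apply, zero_add, smul_eq_mul]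
    congr 1
    change ((16 : ℂ) ^ 0)⁻¹ = 1
    simp
  rw [Set.mem_ofPred_eq, Set.mem_ofPred_eq, hcoord] at hm
  rcases hxρ m with h0 | ⟨n, hnm, hn⟩
  · rw [h0] at hm
    simp at hm
  · have h16 : 2 ≤ ‖(16 : ℂ) ^ m * x m‖ := by
      have hpos : 0 < ‖α (ι n)‖ := norm_pos_iff.2 (hα0 _)
      rw [norm_mul, norm_mul, norm_pow, Complex.norm_ofNat, mul_comm 2, mul_assoc] at hn
      have h2 : 2 ≤ (16 : ℝ) ^ n * ‖x m‖ := le_of_mul_le_mul_left hn hpos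
      rw [norm_mul, norm_pow, Complex.norm_ofNat]
      refine h2.trans ?_
      gcongr
      norm_num
    have h3 : ‖(16 : ℂ) ^ m * x m‖ ≤ ‖(16 : ℂ) ^ m * x m + 1‖ + ‖(1 : ℂ)‖ := by
      simpa using norm_sub_le ((16 : ℂ) ^ m * x m + 1) 1
    rw [norm_one] at h3
    linarith

end Necessary

theorem theorem5p1 (F : Set (Set ℕ)) (hF : IsHypercyclicitySet F) (Γ : Set ℂ) :
    (IsHypercyclicScalarSet.{u} F Γ →
      (Γ \ {0}).Nonempty ∧ Bornology.IsBounded (Γ \ {0}) ∧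
        decreasingNullSeqs Γ ⊆ ratioNullSeqs Γ) ∧
    (IsRightInvariant F → ComplClosedUnderUnion F →
      (Γ \ {0}).Nonempty → Bornology.IsBounded (Γ \ {0}) → IsBoundedAwayFromZero (Γ \ {0}) →
        IsHypercyclicScalarSet.{u} F Γ) := by
  refine ⟨fun h => ⟨h.nonempty hF, h.isBounded hF, ?_⟩, fun hr hc hne hbd hbz =>
    isHypercyclicScalarSet_of_annulus hF.furstenberg hr hc hne hbd hbz⟩
  rw [h.decreasingNullSeqs_eq_empty hF]
  exact Set.empty_subset _
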